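/- Let $E$ be a real Banach lattice, with norm dual $E'$ ordered by $f\le g$ iff $f(x)\le g(x)$ for all $x\ge 0$. A bounded set $A\subset E$ is called \emph{disjointly weakly compact} if every sequence $(x_n)$ in its solid hull $\{y\in E:\ |y|\le |x| \text{ for some } x\in A\}$ with $|x_m|\wedge|x_n|=0$ for all $m\neq n$ converges weakly to $0$. A bounded linear operator $T:E\to X$ into a Banach space is called \emph{DW-compact} if $T(A)$ is relatively compact for every disjointly weakly compact set $A\subset E$, \emph{Dunford--Pettis} if $\|Tx_n\|\to 0$ for every weakly null sequence $(x_n)$ in $E$, and \emph{weakly compact} (resp. \emph{compact}) if it maps the closed unit ball of $E$ onto a relatively weakly compact (resp. relatively compact) set. The norm of $E'$ is \emph{order continuous} if every decreasing net in $E'$ with infimum $0$ converges to $0$ in norm. Then the following statements are equivalent. 1. $E$ has the reciprocal (d)-DP property, that is, every DW-compact operator from $E$ into an arbitrary Banach space is weakly compact. 2. $E'$ has order continuous norm. 3. Every DW-compact operator from $E$ into an arbitrary Banach space is compact. 4. $E$ has the reciprocal Dunford--Pettis property, that is, every Dunford--Pettis operator from $E$ into an arbitrary Banach space is weakly compact.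 -/

import Mathlib

universe u v

namespace BanachLattice

section Dual

variable {E : Type*} [NormedAddCommGroup E] [NormedSpace ℝ E] [Lattice E] [IsOrderedAddMonoid E]

/-- The canonical order of the norm dual `E'` of a normed lattice: `f ≤ g` if and only if
`f x ≤ g x` for all `x ≥ 0`. -/
instance instPartialOrderDual : PartialOrder (StrongDual ℝ E) where
  le f g := ∀ x : E, 0 ≤ x → f x ≤ g x
  le_refl _ _ _ := le_rfl
  le_trans _ _ _ hfg hgh x hx := (hfg x hx).trans (hgh x hx)
  le_antisymm f g hfg hgf := by
    ext x
    have h : ∀ y : E, 0 ≤ y → f y = g y := fun y hy => le_antisymm (hfg y hy) (hgf y hy)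
    rw [← posPart_sub_negPart x, map_sub, map_sub, h _ (posPart_nonneg x), h _ (negPart_nonneg x)]

theorem dual_le_iff (f g : StrongDual ℝ E) : f ≤ g ↔ ∀ x : E, 0 ≤ x → f x ≤ g x := Iff.rfl

end Dual

/-- The norm of `F` is order continuous: every nonempty downward directed set `D` with infimum `0`,
regarded as a decreasing net indexed by itself, converges to `0` in norm. -/
def HasOrderContinuousNorm (F : Type*) [NormedAddCommGroup F] [PartialOrder F] : Prop :=
  ∀ D : Set F, D.Nonempty → DirectedOn (· ≥ ·) D → IsGLB D 0 →
    ∀ ε : ℝ, 0 < ε → ∃ f ∈ D, ∀ g ∈ D, g ≤ f → ‖g‖ < ε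

/-- The sequence `x` converges to `0` in the weak topology. -/
def IsWeaklyNull {E : Type*} [NormedAddCommGroup E] [NormedSpace ℝ E] (x : ℕ → E) : Prop :=
  Filter.Tendsto (fun n => toWeakSpace ℝ E (x n)) Filter.atTop (nhds 0)

theorem isWeaklyNull_iff {E : Type*} [NormedAddCommGroup E] [NormedSpace ℝ E] (x : ℕ → E) :
    IsWeaklyNull x ↔
      ∀ f : StrongDual ℝ E, Filter.Tendsto (fun n => f (x n)) Filter.atTop (nhds 0) := by
  have hinj : Function.Injective ((topDualPairing ℝ E).flip) := by
    intro a b h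
    refine SeparatingDual.eq_iff_forall_dual_eq (R := ℝ) |>.2 fun f => ?_
    exact congrArg (fun l => l f) h
  have h := WeakBilin.tendsto_iff_forall_eval_tendsto (topDualPairing ℝ E).flip hinj
    (f := fun n => (toWeakSpace ℝ E (x n))) (l := Filter.atTop) (x := 0)
  refine h.trans (forall_congr' fun f => ?_)
  change Filter.Tendsto (fun n => f (x n)) Filter.atTop (nhds (f 0)) ↔ _
  rw [map_zero]

/-- The terms of the sequence `x` are pairwise disjoint in the lattice sense. -/
def IsDisjointSeq {E : Type*} [AddCommGroup E] [Lattice E] (x : ℕ → E) : Prop :=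
  Pairwise fun m n => |x m| ⊓ |x n| = 0

/-- A bounded set `A` all of whose solid hull's disjoint sequences are weakly null. -/
def IsDisjointlyWeaklyCompact {E : Type*} [NormedAddCommGroup E] [NormedSpace ℝ E] [Lattice E]
    (A : Set E) : Prop :=
  Bornology.IsBounded A ∧
    ∀ x : ℕ → E, (∀ n, x n ∈ LatticeOrderedAddCommGroup.solidClosure A) → IsDisjointSeq x →
      IsWeaklyNull x

section Operators

variable {E X : Type*} [NormedAddCommGroup E] [NormedSpace ℝ E]
  [NormedAddCommGroup X] [NormedSpace ℝ X]

/-- `T` maps disjointly weakly compact sets onto relatively compact sets. -/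
def IsDWCompact [Lattice E] (T : E →L[ℝ] X) : Prop :=
  ∀ A : Set E, IsDisjointlyWeaklyCompact A → IsCompact (closure (T '' A))

/-- `T` maps weakly null sequences to norm null sequences. -/
def IsDunfordPettis (T : E →L[ℝ] X) : Prop :=
  ∀ x : ℕ → E, IsWeaklyNull x → Filter.Tendsto (fun n => T (x n)) Filter.atTop (nhds 0)

/-- `T` maps the closed unit ball onto a relatively weakly compact set. -/
def IsWeaklyCompact (T : E →L[ℝ] X) : Prop :=
  IsCompact (closure (toWeakSpace ℝ X '' (T '' Metric.closedBall 0 1)))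

end Operators

/-- Every DW-compact operator from `E` into an arbitrary Banach space is weakly compact. -/
def HasReciprocalDDPProperty (E : Type u) [NormedAddCommGroup E] [NormedSpace ℝ E] [Lattice E] :
    Prop :=
  ∀ (X : Type v) [NormedAddCommGroup X] [NormedSpace ℝ X] [CompleteSpace X] (T : E →L[ℝ] X),
    IsDWCompact T → IsWeaklyCompact T

/-- Every Dunford-Pettis operator from `E` into an arbitrary Banach space is weakly compact. -/
def HasReciprocalDPProperty (E : Type u) [NormedAddCommGroup E] [NormedSpace ℝ E] : Prop :=
  ∀ (X : Type v) [NormedAddCommGroup X] [NormedSpace ℝ X] [CompleteSpace X] (T : E →L[ℝ] X),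
    IsDunfordPettis T → IsWeaklyCompact T

end BanachLattice

/-! All four statements are equivalent to one condition: bounded disjoint sequences of `E` are
weakly null. Order continuity of the dual norm gives it, because the parts of a positive functional
on disjoint bands form a series whose tails decrease to `0`. Conversely, the condition makes the
unit ball almost order bounded for each positive functional, so a directed set in the dual with
infimum `0` becomes small in norm.

Under the condition the unit ball is disjointly weakly compact, so DW-compact operators are compact.
A Dunford-Pettis operator then sends bounded disjoint sequences to norm null ones, and
`isWeaklyCompact_of_tendsto_of_isDisjointSeq` applies: on order intervals the functionals `|f ∘ T|`,
`‖f‖ ≤ 1`, are controlled, up to any given error, by a finite sum of them; convex blocks are close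
in the seminorm of that sum; and a James-type criterion turns closeness of blocks into weak
compactness.

If the condition fails, `exists_not_isWeaklyCompact` takes the band parts of a positive functional
as coordinates of an operator into `ℓ¹`. It is Dunford-Pettis by the Schur property and DW-compact
by almost order boundedness, but it sends a bounded disjoint sequence to multiples of unit vectors
bounded away from `0`, so it is not weakly compact. -/

namespace BanachLattice

/-! ### Inequalities in lattice ordered groups -/

section LatticeGroup

variable {E : Type*} [AddCommGroup E] [Lattice E] [IsOrderedAddMonoid E]

theorem sup_inf_distrib_right (a b c : E) : (a ⊔ b) ⊓ c = a ⊓ c ⊔ b ⊓ c := by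
  let := AddCommGroup.toDistribLattice E
  exact inf_sup_right a b c

/-- Pointwise, where `t + e ≤ r + 2 • e` the cap at `r + 2 • e` has no effect; elsewhere `t - r`
exceeds `e`, which bounds the increment. Summed over levels, the capped increments telescope to at
most `2 • e`. -/
theorem inf_sup_sub_le (p r t e : E) (he : 0 ≤ e) :
    (p ⊓ (t + e)) ⊔ r - (p ⊓ t) ⊔ r ≤ (p ⊔ r - t)⁺ ⊓ (t - r)⁺ +
      ((p ⊓ (r + 2 • e) ⊓ (t + e)) ⊔ r - (p ⊓ (r + 2 • e) ⊓ t) ⊔ r) := by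
  have hte : t ≤ t + e := le_add_of_nonneg_right he
  have hre : r ≤ r + 2 • e := le_add_of_nonneg_right (nsmul_nonneg he 2)
  rw [← sub_le_iff_le_add]
  refine le_inf ?_ ?_
  · have h1 : (p ⊓ (t + e)) ⊔ r ≤ (p ⊔ r - t)⁺ + (p ⊓ t) ⊔ r := by
      have h : p ⊔ r - (p ⊔ r) ⊓ t = (p ⊔ r - t)⁺ := by
        rw [sub_inf, sub_self, sup_comm]; rfl
      have h2 : (p ⊔ r) ⊓ t ≤ (p ⊓ t) ⊔ r := by
        rw [sup_inf_distrib_right]; exact sup_le_sup_left inf_le_left _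
      calc (p ⊓ (t + e)) ⊔ r ≤ p ⊔ r := sup_le_sup_right inf_le_left _
        _ = (p ⊔ r - t)⁺ + (p ⊔ r) ⊓ t := by rw [← h]; abel
        _ ≤ _ := by gcongr
    have h3 : (p ⊓ (r + 2 • e) ⊓ t) ⊔ r ≤ (p ⊓ (r + 2 • e) ⊓ (t + e)) ⊔ r := by gcongr
    have h4 := sub_le_iff_le_add.2 h1
    exact (sub_le_self _ (sub_nonneg.2 h3)).trans h4
  · set A := (p ⊓ (t + e)) ⊔ r with hA
    have hA' : (p ⊓ (r + 2 • e) ⊓ (t + e)) ⊔ r = A ⊓ (r + 2 • e) := by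
      rw [hA, sup_inf_distrib_right, inf_eq_left.2 hre]; congr 1; ac_rfl
    have h1 : (p ⊓ (r + 2 • e) ⊓ t) ⊔ r ≤ (p ⊓ t) ⊔ r := by
      gcongr; exact inf_le_left
    have h2 : A - A ⊓ (r + 2 • e) ≤ (t - r)⁺ := by
      rw [sub_inf, sub_self]
      refine sup_le (posPart_nonneg _) ?_
      rw [sub_le_iff_le_add]
      refine sup_le (inf_le_right.trans ?_) ?_
      · have := le_posPart (t - r)
        calc t + e = (t - r) + (r + e) := by abel
          _ ≤ (t - r)⁺ + (r + 2 • e) := by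
            gcongr
            rw [two_nsmul]; exact le_add_of_nonneg_right he
      · exact hre.trans (le_add_of_nonneg_left (posPart_nonneg _))
    rw [hA']
    calc A - (p ⊓ t) ⊔ r - (A ⊓ (r + 2 • e) - (p ⊓ (r + 2 • e) ⊓ t) ⊔ r)
        = (A - A ⊓ (r + 2 • e)) - ((p ⊓ t) ⊔ r - (p ⊓ (r + 2 • e) ⊓ t) ⊔ r) := by abel
      _ ≤ A - A ⊓ (r + 2 • e) := sub_le_self _ (sub_nonneg.2 h1)
      _ ≤ _ := h2

/-- If `r ≤ p` lie between the ends of the arithmetic progression `t + j • e`, then `p - r` is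
bounded by `2 • e` plus the sum of the amounts by which `p` and `r` are separated by its terms. -/
theorem sub_le_two_nsmul_add_sum (p r t e : E) (he : 0 ≤ e) (N : ℕ) (hrp : r ≤ p) (htr : t ≤ r)
    (hpt : p ≤ t + N • e) :
    p - r ≤ 2 • e + ∑ j ∈ Finset.range N, (p - (t + j • e))⁺ ⊓ ((t + j • e) - r)⁺ := by
  have hstep : ∀ j : ℕ, (p ⊓ (t + (j + 1) • e)) ⊔ r - (p ⊓ (t + j • e)) ⊔ r
      ≤ (p - (t + j • e))⁺ ⊓ ((t + j • e) - r)⁺ +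
      ((p ⊓ (r + 2 • e) ⊓ (t + (j + 1) • e)) ⊔ r - (p ⊓ (r + 2 • e) ⊓ (t + j • e)) ⊔ r) := by
    intro j
    have := inf_sup_sub_le p r (t + j • e) e he
    rwa [add_assoc, ← succ_nsmul, sup_eq_left.2 hrp] at this
  have hsum := Finset.sum_le_sum fun j (_ : j ∈ Finset.range N) => hstep j
  rw [Finset.sum_add_distrib, Finset.sum_range_sub (fun j : ℕ => (p ⊓ (t + j • e)) ⊔ r),
    Finset.sum_range_sub (fun j : ℕ => (p ⊓ (r + 2 • e) ⊓ (t + j • e)) ⊔ r)] at hsum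
  have h1 : (p ⊓ (t + N • e)) ⊔ r = p := by rw [inf_eq_left.2 hpt, sup_eq_left.2 hrp]
  have h2 : (p ⊓ (t + 0 • e)) ⊔ r = r := by
    rw [zero_nsmul, add_zero]; exact sup_eq_right.2 (inf_le_right.trans htr)
  rw [h1, h2] at hsum
  refine hsum.trans ?_
  rw [add_comm]
  gcongr
  rw [sub_le_iff_le_add]
  refine (sup_le (inf_le_left.trans inf_le_right) ?_).trans
    (b := r + 2 • e) ?_
  · exact le_add_of_nonneg_right (nsmul_nonneg he 2)
  · rw [add_comm]; gcongr; exact le_sup_right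

/-- A triangle inequality with its slack: it gains wherever `t` separates `x` from `y`. The proof
writes `|a|` both as `a + 2 • a⁻` and as `-a + 2 • a⁺`. -/
theorem abs_add_add_two_nsmul_le (x y t : E) :
    |x + y - 2 • t| + 2 • ((x ⊔ y - t)⁺ ⊓ (t - x ⊓ y)⁺) ≤ |x - t| + |y - t| := by
  have key : ∀ a : E, |a| = a + 2 • a⁻ := fun a => by
    have h1 := posPart_sub_negPart a
    have h2 := posPart_add_negPart a
    calc |a| = (a⁺ - a⁻) + 2 • a⁻ := by rw [← h2, two_nsmul]; abel
      _ = a + 2 • a⁻ := by rw [h1]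
  have key' : ∀ a : E, |a| = -a + 2 • a⁺ := fun a => by
    have h1 := posPart_sub_negPart a
    have h2 := posPart_add_negPart a
    calc |a| = -(a⁺ - a⁻) + 2 • a⁺ := by rw [← h2, two_nsmul]; abel
      _ = -a + 2 • a⁺ := by rw [h1]
  have hs : (x ⊔ y - t)⁺ ≤ (x - t)⁺ + (y - t)⁺ := by
    rw [sup_sub, posPart_def]
    refine sup_le (sup_le ?_ ?_) (add_nonneg (posPart_nonneg _) (posPart_nonneg _))
    · exact (le_posPart _).trans (le_add_of_nonneg_right (posPart_nonneg _))
    · exact (le_posPart _).trans (le_add_of_nonneg_left (posPart_nonneg _))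
  have hi : (t - x ⊓ y)⁺ ≤ (x - t)⁻ + (y - t)⁻ := by
    rw [sub_inf, posPart_def, negPart_def, negPart_def, neg_sub, neg_sub]
    refine sup_le (sup_le ?_ ?_) (add_nonneg le_sup_right le_sup_right)
    · exact le_sup_left.trans (le_add_of_nonneg_right le_sup_right)
    · exact le_sup_left.trans (le_add_of_nonneg_left le_sup_right)
  set m := (x ⊔ y - t)⁺ ⊓ (t - x ⊓ y)⁺
  rw [← le_sub_iff_add_le]
  refine abs_le'.2 ⟨?_, ?_⟩
  · rw [le_sub_iff_add_le, key (x - t), key (y - t)]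
    calc x + y - 2 • t + 2 • m ≤ x + y - 2 • t + 2 • ((x - t)⁻ + (y - t)⁻) := by
          gcongr; exact inf_le_right.trans hi
      _ = _ := by simp only [two_nsmul]; abel
  · rw [le_sub_iff_add_le, key' (x - t), key' (y - t)]
    calc -(x + y - 2 • t) + 2 • m ≤ -(x + y - 2 • t) + 2 • ((x - t)⁺ + (y - t)⁺) := by
          gcongr; exact inf_le_left.trans hs
      _ = _ := by simp only [two_nsmul]; abel

theorem inf_add_le_inf_add_inf {x y z : E} (hx : 0 ≤ x) (hy : 0 ≤ y) (hz : 0 ≤ z) :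
    (x + y) ⊓ z ≤ x ⊓ z + y ⊓ z := by
  rw [inf_add, add_inf, add_inf]
  refine le_inf (le_inf inf_le_left ?_) (le_inf ?_ ?_)
  · exact inf_le_right.trans (le_add_of_nonneg_left hx)
  · exact inf_le_right.trans (le_add_of_nonneg_right hy)
  · exact inf_le_right.trans (le_add_of_nonneg_right hz)

/-- Truncation of `x` to the order interval `[-u, u]`. -/
theorem abs_sub_truncate_le (x u : E) :
    |x - (x ⊓ u) ⊔ (-u)| ≤ (|x| - u)⁺ := by
  refine abs_le'.2 ⟨?_, ?_⟩
  · rw [sub_le_iff_le_add]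
    calc x ≤ (x - u)⁺ + x ⊓ u := by
          rw [inf_eq_sub_posPart_sub]; simp
      _ ≤ _ := by
        gcongr
        · exact posPart_mono (sub_le_sub_right (le_abs_self x) u)
        · exact le_sup_left
  · rw [neg_sub, sub_le_iff_le_add]
    refine sup_le (inf_le_left.trans (le_add_of_nonneg_left (posPart_nonneg _))) ?_
    have h : -x - u ≤ (|x| - u)⁺ :=
      (sub_le_sub_right (neg_le_abs x) u).trans (le_posPart _)
    calc -u = (-x - u) + x := by abel
      _ ≤ _ := by gcongr

theorem abs_truncate_le (x : E) {u : E} (hu : 0 ≤ u) : |(x ⊓ u) ⊔ (-u)| ≤ u :=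
  abs_le'.2 ⟨sup_le inf_le_right (neg_le_self hu), neg_le.1 le_sup_right⟩

/-- Riesz decomposition for the modulus. -/
theorem exists_add_of_abs_le_add {y a b : E} (ha : 0 ≤ a) (hb : 0 ≤ b) (h : |y| ≤ a + b) :
    ∃ y₁ y₂, y = y₁ + y₂ ∧ |y₁| ≤ a ∧ |y₂| ≤ b := by
  refine ⟨(y ⊓ a) ⊔ (-a), y - (y ⊓ a) ⊔ (-a), by abel, abs_truncate_le y ha,
    (abs_sub_truncate_le y a).trans ?_⟩
  exact sup_le (sub_le_iff_le_add'.2 h) hb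

end LatticeGroup

/-! ### Construction of functionals from the positive cone -/

section Functionals

variable {E : Type*} [NormedAddCommGroup E] [NormedSpace ℝ E] [Lattice E] [IsOrderedAddMonoid E]

theorem dual_monotone {g : StrongDual ℝ E} (hg : 0 ≤ g) : Monotone g := fun x y hxy => by
  have h : 0 ≤ g (y - x) := hg _ (sub_nonneg.2 hxy)
  rw [map_sub] at h
  linarith

theorem abs_apply_le {g : StrongDual ℝ E} (hg : 0 ≤ g) (x : E) : |g x| ≤ g |x| :=
  abs_le'.2 ⟨dual_monotone hg (le_abs_self x),
    by rw [← map_neg]; exact dual_monotone hg (neg_le_abs x)⟩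

variable [HasSolidNorm E]

omit [NormedSpace ℝ E] in
theorem norm_le_norm_of_nonneg_of_le {x y : E} (hx : 0 ≤ x) (hxy : x ≤ y) : ‖x‖ ≤ ‖y‖ :=
  norm_le_norm_of_abs_le_abs (by rwa [abs_of_nonneg hx, abs_of_nonneg (hx.trans hxy)])

theorem dual_norm_le {g : StrongDual ℝ E} (hg : 0 ≤ g) {C : ℝ} (hC : 0 ≤ C)
    (h : ∀ x, 0 ≤ x → g x ≤ C * ‖x‖) : ‖g‖ ≤ C :=
  g.opNorm_le_bound hC fun x =>
    (abs_apply_le hg x).trans ((h _ (abs_nonneg x)).trans_eq (by rw [norm_abs_eq_norm]))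

/-- An additive bounded function on the positive cone extends to a bounded linear functional. -/
theorem exists_dual_of_additive (P : E → ℝ) (C : ℝ)
    (hadd : ∀ x y, 0 ≤ x → 0 ≤ y → P (x + y) = P x + P y)
    (hC : ∀ x, 0 ≤ x → |P x| ≤ C * ‖x‖) :
    ∃ f : StrongDual ℝ E, ∀ x, 0 ≤ x → f x = P x := by
  have h0 : P 0 = 0 := by have := hadd 0 0 le_rfl le_rfl; simp at this; exact this
  have key : ∀ a b : E, 0 ≤ a → 0 ≤ b → P (a - b)⁺ - P (a - b)⁻ = P a - P b := by
    intro a b ha hb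
    have h : (a - b)⁺ + b = (a - b)⁻ + a := by
      have := posPart_sub_negPart (a - b)
      rw [sub_eq_sub_iff_add_eq_add] at this
      rw [this, add_comm]
    have h1 := hadd _ _ (posPart_nonneg (a - b)) hb
    have h2 := hadd _ _ (negPart_nonneg (a - b)) ha
    rw [h] at h1
    linarith
  let F : E →+ ℝ :=
    { toFun := fun x => P x⁺ - P x⁻
      map_zero' := by simp
      map_add' := fun x y => by
        have h : x + y = (x⁺ + y⁺) - (x⁻ + y⁻) := by
          nth_rewrite 1 [← posPart_sub_negPart x, ← posPart_sub_negPart y]; abel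
        have hp : ∀ z : E, 0 ≤ z⁺ := posPart_nonneg
        have hn : ∀ z : E, 0 ≤ z⁻ := negPart_nonneg
        rw [h, key _ _ (add_nonneg (hp x) (hp y)) (add_nonneg (hn x) (hn y)),
          hadd _ _ (hp x) (hp y), hadd _ _ (hn x) (hn y)]
        ring }
  have hF : ∀ x, ‖F x‖ ≤ (2 * |C|) * ‖x‖ := by
    intro x
    have h1 : ‖x⁺‖ ≤ ‖x‖ := norm_le_norm_of_abs_le_abs (by
      rw [abs_of_nonneg (posPart_nonneg x)]
      exact (le_add_of_nonneg_right (negPart_nonneg x)).trans_eq (posPart_add_negPart x))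
    have h2 : ‖x⁻‖ ≤ ‖x‖ := norm_le_norm_of_abs_le_abs (by
      rw [abs_of_nonneg (negPart_nonneg x)]
      exact (le_add_of_nonneg_left (posPart_nonneg x)).trans_eq (posPart_add_negPart x))
    have h3 : ∀ z : E, 0 ≤ z → ‖z‖ ≤ ‖x‖ → |P z| ≤ |C| * ‖x‖ := fun z hz hzx =>
      (hC z hz).trans (mul_le_mul (le_abs_self C) hzx (norm_nonneg _) (abs_nonneg _))
    calc ‖F x‖ = |P x⁺ - P x⁻| := rfl
      _ ≤ |P x⁺| + |P x⁻| := abs_sub _ _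
      _ ≤ |C| * ‖x‖ + |C| * ‖x‖ := add_le_add (h3 _ (posPart_nonneg x) h1)
        (h3 _ (negPart_nonneg x) h2)
      _ = _ := by ring
  -- Real homogeneity is not assumed of `P`; it follows from additivity and continuity, which is all
  -- that the crude bound `2 * |C|` serves.
  refine ⟨F.toRealLinearMap (AddMonoidHomClass.continuous_of_bound F _ hF), fun x hx => ?_⟩
  change P x⁺ - P x⁻ = P x
  rw [posPart_of_nonneg hx, negPart_of_nonneg hx, h0, sub_zero]

/-- Existence of the modulus of a bounded linear functional. -/
theorem exists_modulus (h : StrongDual ℝ E) :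
    ∃ g : StrongDual ℝ E, 0 ≤ g ∧ ∀ x, 0 ≤ x → IsLUB (h '' {y | |y| ≤ x}) (g x) := by
  have hub : ∀ x : E, 0 ≤ x → ∀ y : E, |y| ≤ x → h y ≤ ‖h‖ * ‖x‖ := fun x hx y hy =>
    (le_abs_self _).trans <| (h.le_opNorm y).trans <| mul_le_mul_of_nonneg_left
      (norm_le_norm_of_abs_le_abs (by rwa [abs_of_nonneg hx])) (norm_nonneg _)
  have hlub : ∀ x : E, 0 ≤ x → IsLUB (h '' {y | |y| ≤ x}) (sSup (h '' {y | |y| ≤ x})) := by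
    refine fun x hx => isLUB_csSup ⟨h 0, 0, by simpa using hx, rfl⟩ ⟨‖h‖ * ‖x‖, ?_⟩
    rintro _ ⟨y, hy, rfl⟩
    exact hub x hx y hy
  have hpos : ∀ x : E, 0 ≤ x → 0 ≤ sSup (h '' {y | |y| ≤ x}) := fun x hx =>
    (hlub x hx).1 ⟨0, by simpa using hx, map_zero h⟩
  suffices hex : ∃ f : StrongDual ℝ E, ∀ v, 0 ≤ v →
      f v = (fun x => sSup (h '' {y | |y| ≤ x})) v by
    obtain ⟨g, hg⟩ := hex
    refine ⟨g, fun x hx => ?_, fun x hx => ?_⟩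
    · rw [hg x hx]; exact hpos x hx
    · rw [hg x hx]; exact hlub x hx
  refine exists_dual_of_additive _ ‖h‖ ?_ ?_
  · intro x y hx hy
    apply le_antisymm
    · refine (isLUB_le_iff (hlub _ (add_nonneg hx hy))).2 ?_
      rintro _ ⟨z, hz, rfl⟩
      obtain ⟨a, b, rfl, ha, hb⟩ := exists_add_of_abs_le_add hx hy hz
      rw [map_add]
      exact add_le_add ((hlub x hx).1 ⟨a, ha, rfl⟩) ((hlub y hy).1 ⟨b, hb, rfl⟩)
    · rw [← le_sub_iff_add_le]
      refine (isLUB_le_iff (hlub x hx)).2 ?_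
      rintro _ ⟨a, ha, rfl⟩
      rw [le_sub_comm]
      refine (isLUB_le_iff (hlub y hy)).2 ?_
      rintro _ ⟨b, hb, rfl⟩
      rw [le_sub_iff_add_le', ← map_add]
      exact (hlub _ (add_nonneg hx hy)).1
        ⟨a + b, (abs_add_le a b).trans (add_le_add ha hb), rfl⟩
  · intro x hx
    rw [abs_of_nonneg (hpos x hx)]
    refine (isLUB_le_iff (hlub x hx)).2 ?_
    rintro _ ⟨y, hy, rfl⟩
    exact hub x hx y hy

/-- Since `D` is directed, its pointwise infimum is additive on the cone and so extends to a
functional. That functional is a lower bound of `D`, hence `≤ 0`. -/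
theorem exists_apply_lt_of_isGLB {D : Set (StrongDual ℝ E)} (hne : D.Nonempty)
    (hdir : DirectedOn (· ≥ ·) D) (hglb : IsGLB D 0) {u : E} (hu : 0 ≤ u) {ε : ℝ} (hε : 0 < ε) :
    ∃ f ∈ D, f u < ε := by
  have hG : ∀ x : E, 0 ≤ x →
      IsGLB ((fun f : StrongDual ℝ E => f x) '' D) (sInf ((fun f : StrongDual ℝ E => f x) '' D)) := by
    refine fun x hx => isGLB_csInf (hne.image _) ⟨0, ?_⟩
    rintro _ ⟨f, hf, rfl⟩
    exact hglb.1 hf x hx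
  have hpos : ∀ x : E, 0 ≤ x → 0 ≤ sInf ((fun f : StrongDual ℝ E => f x) '' D) := by
    refine fun x hx => (le_isGLB_iff (hG x hx)).2 ?_
    rintro _ ⟨f, hf, rfl⟩
    exact hglb.1 hf x hx
  obtain ⟨f₀, hf₀⟩ := hne
  suffices hex : ∃ f : StrongDual ℝ E, ∀ v, 0 ≤ v →
      f v = (fun x => sInf ((fun f : StrongDual ℝ E => f x) '' D)) v by
    obtain ⟨g, hg⟩ := hex
    have hle : g ≤ 0 := hglb.2 fun f hf x hx => by
      rw [hg x hx]; exact (hG x hx).1 ⟨f, hf, rfl⟩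
    have h := hle u hu
    rw [hg u hu] at h
    obtain ⟨_, ⟨f, hf, rfl⟩, -, hlt⟩ := (hG u hu).exists_between (lt_of_le_of_lt h hε)
    exact ⟨f, hf, hlt⟩
  refine exists_dual_of_additive _ ‖f₀‖ ?_ ?_
  · intro x y hx hy
    apply le_antisymm
    · rw [← sub_le_iff_le_add]
      refine (le_isGLB_iff (hG x hx)).2 ?_
      rintro _ ⟨f₁, hf₁, rfl⟩
      rw [sub_le_comm]
      refine (le_isGLB_iff (hG y hy)).2 ?_
      rintro _ ⟨f₂, hf₂, rfl⟩
      obtain ⟨f, hf, h1, h2⟩ := hdir f₁ hf₁ f₂ hf₂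
      have h3 := (hG _ (add_nonneg hx hy)).1 ⟨f, hf, rfl⟩
      have h4 : f x ≤ f₁ x := h1 x hx
      have h5 : f y ≤ f₂ y := h2 y hy
      have h6 : f (x + y) = f x + f y := map_add f x y
      exact h3.trans (by dsimp only; linarith) |> (sub_le_iff_le_add'.2 ·)
    · refine (le_isGLB_iff (hG _ (add_nonneg hx hy))).2 ?_
      rintro _ ⟨f, hf, rfl⟩
      simp only [map_add]
      exact add_le_add ((hG x hx).1 ⟨f, hf, rfl⟩) ((hG y hy).1 ⟨f, hf, rfl⟩)
  · intro x hx
    rw [abs_of_nonneg (hpos x hx)]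
    exact ((hG x hx).1 ⟨f₀, hf₀, rfl⟩).trans ((le_abs_self _).trans (f₀.le_opNorm x))

/-- The part of the positive functional `g` that is carried by the band generated by `x`. -/
theorem exists_bandPart {g : StrongDual ℝ E} (hg : 0 ≤ g) {x : E} (hx : 0 ≤ x) :
    ∃ f : StrongDual ℝ E, ∀ y, 0 ≤ y →
      IsLUB (Set.range fun k : ℕ => g (y ⊓ (k • x))) (f y) := by
  have hkx : ∀ k : ℕ, 0 ≤ k • x := fun k => nsmul_nonneg hx k
  have hub : ∀ y : E, ∀ k : ℕ, g (y ⊓ (k • x)) ≤ g y := fun y k =>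
    dual_monotone hg inf_le_left
  have hlub : ∀ y : E, 0 ≤ y → IsLUB (Set.range fun k : ℕ => g (y ⊓ (k • x)))
      (sSup (Set.range fun k : ℕ => g (y ⊓ (k • x)))) := by
    refine fun y hy => isLUB_csSup (Set.range_nonempty _) ⟨g y, ?_⟩
    rintro _ ⟨k, rfl⟩
    exact hub y k
  have hpos : ∀ y : E, 0 ≤ y → 0 ≤ sSup (Set.range fun k : ℕ => g (y ⊓ (k • x))) :=
    fun y hy => le_trans (hg _ (le_inf hy (hkx 0))) ((hlub y hy).1 ⟨0, rfl⟩)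
  suffices hex : ∃ f : StrongDual ℝ E, ∀ v, 0 ≤ v →
      f v = (fun y => sSup (Set.range fun k : ℕ => g (y ⊓ (k • x)))) v by
    obtain ⟨f, hf⟩ := hex
    exact ⟨f, fun y hy => by rw [hf y hy]; exact hlub y hy⟩
  refine exists_dual_of_additive _ ‖g‖ ?_ ?_
  · intro y z hy hz
    apply le_antisymm
    · refine (isLUB_le_iff (hlub _ (add_nonneg hy hz))).2 ?_
      rintro _ ⟨k, rfl⟩
      calc g ((y + z) ⊓ (k • x)) ≤ g (y ⊓ (k • x)) + g (z ⊓ (k • x)) := by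
            rw [← map_add]; exact dual_monotone hg (inf_add_le_inf_add_inf hy hz (hkx k))
        _ ≤ _ := add_le_add ((hlub y hy).1 ⟨k, rfl⟩) ((hlub z hz).1 ⟨k, rfl⟩)
    · rw [← le_sub_iff_add_le]
      refine (isLUB_le_iff (hlub y hy)).2 ?_
      rintro _ ⟨k, rfl⟩
      rw [le_sub_comm]
      refine (isLUB_le_iff (hlub z hz)).2 ?_
      rintro _ ⟨l, rfl⟩
      rw [le_sub_iff_add_le']
      refine le_trans ?_ ((hlub _ (add_nonneg hy hz)).1 ⟨k + l, rfl⟩)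
      rw [← map_add]
      refine dual_monotone hg (le_inf (add_le_add inf_le_left inf_le_left) ?_)
      rw [add_smul]
      exact add_le_add inf_le_right inf_le_right
  · intro y hy
    rw [abs_of_nonneg (hpos y hy)]
    refine (isLUB_le_iff (hlub y hy)).2 ?_
    rintro _ ⟨k, rfl⟩
    exact (hub y k).trans ((le_abs_self _).trans (g.le_opNorm y))

end Functionals

open Filter Topology

/-! ### Disjointification and uniform estimates -/

section Uniform

variable {E : Type*} [NormedAddCommGroup E] [NormedSpace ℝ E] [Lattice E] [IsOrderedAddMonoid E]
  {ι : Type*}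

/-- The functionals `g i` tend to `0` along the sequence `v`, uniformly in `i`, from above. -/
def IsUniformlyNull (g : ι → StrongDual ℝ E) (v : ℕ → E) : Prop :=
  ∀ ε : ℝ, 0 < ε → ∀ᶠ n in atTop, ∀ i, g i (v n) ≤ ε

omit [NormedSpace ℝ E] in
theorem isDisjointSeq_of_nonneg {v : ℕ → E} (hv : ∀ n, 0 ≤ v n)
    (h : ∀ m n, m < n → v m ⊓ v n ≤ 0) : IsDisjointSeq v := by
  have key : ∀ m n, m < n → |v m| ⊓ |v n| = 0 := fun m n hmn => by
    rw [abs_of_nonneg (hv m), abs_of_nonneg (hv n)]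
    exact le_antisymm (h m n hmn) (le_inf (hv m) (hv n))
  intro m n hmn
  rcases lt_or_gt_of_ne hmn with h | h
  · exact key m n h
  · rw [inf_comm]; exact key n m h

omit [Lattice E] [IsOrderedAddMonoid E] in
theorem apply_le_mul {g : StrongDual ℝ E} {C : ℝ} (hC : ‖g‖ ≤ C) (x : E) : g x ≤ C * ‖x‖ :=
  (le_abs_self _).trans ((g.le_opNorm x).trans (mul_le_mul_of_nonneg_right hC (norm_nonneg _)))

/-- As `c⁻¹ ≤ 1`, the first factor is at most `(a - c • b)⁻`, which is disjoint from the second. -/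
theorem posPart_sub_smul_inf_le [IsOrderedModule ℝ E] (a b : E) {c : ℝ} (hc : 1 ≤ c) :
    (b - c⁻¹ • a)⁺ ⊓ (a - c • b)⁺ ≤ 0 := by
  have hc0 : 0 < c := by linarith
  have h : (b - c⁻¹ • a)⁺ ≤ (a - c • b)⁻ := by
    refine sup_le ?_ (negPart_nonneg _)
    have h1 : b - c⁻¹ • a = c⁻¹ • (-(a - c • b)) := by
      rw [neg_sub, smul_sub, smul_smul, inv_mul_cancel₀ hc0.ne', one_smul]
    rw [h1]
    calc c⁻¹ • (-(a - c • b)) ≤ c⁻¹ • (a - c • b)⁻ :=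
          smul_le_smul_of_nonneg_left (neg_le_negPart _) (by positivity)
      _ ≤ (1 : ℝ) • (a - c • b)⁻ :=
          smul_le_smul_of_nonneg_right (inv_le_one_of_one_le₀ hc) (negPart_nonneg _)
      _ = _ := one_smul _ _
  calc _ ≤ (a - c • b)⁻ ⊓ (a - c • b)⁺ := inf_le_inf_right _ h
    _ = 0 := by rw [inf_comm]; exact posPart_inf_negPart_eq_zero _

/-- If the positive functionals `g i` tend to `0` uniformly along the disjoint sequences of the
solid hull of `A`, then `A` is almost order bounded with respect to them. -/
theorem exists_forall_apply_posPart_abs_sub_le [IsOrderedModule ℝ E] [HasSolidNorm E]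
    [CompleteSpace E] {g : ι → StrongDual ℝ E} (hg : ∀ i, 0 ≤ g i) {C : ℝ} (hC : ∀ i, ‖g i‖ ≤ C)
    {A : Set E} (hA : Bornology.IsBounded A)
    (H : ∀ v : ℕ → E, (∀ n, 0 ≤ v n) → (∀ n, v n ∈ LatticeOrderedAddCommGroup.solidClosure A) →
      IsDisjointSeq v → IsUniformlyNull g v) {ε : ℝ} (hε : 0 < ε) :
    ∃ u : E, 0 ≤ u ∧ ∀ x ∈ A, ∀ i, g i (|x| - u)⁺ ≤ ε := by
  by_contra! hcon
  have hcon' : ∀ u : E, ∃ x ∈ A, ∃ i, ε < g i (|x| - |u|)⁺ := fun u => hcon _ (abs_nonneg u)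
  choose X hXA I hI using hcon'
  obtain ⟨M, hM⟩ := isBounded_iff_forall_norm_le.1 hA
  -- Greedy choice: `S n` sums the earlier `a k`, and `a n` exceeds `4 ^ n • S n` by more than `ε`
  -- for some functional of the family.
  let S : ℕ → E := fun n => Nat.rec 0 (fun n s => s + |X ((4 : ℝ) ^ n • s)|) n
  let a : ℕ → E := fun n => |X ((4 : ℝ) ^ n • S n)|
  have hS : ∀ n, S (n + 1) = S n + a n := fun n => rfl
  have ha : ∀ n, 0 ≤ a n := fun n => abs_nonneg _
  have haM : ∀ n, ‖a n‖ ≤ M := fun n => by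
    rw [norm_abs_eq_norm]; exact hM _ (hXA _)
  have hSmono : Monotone S := monotone_nat_of_le_succ fun n => by
    rw [hS]; exact le_add_of_nonneg_right (ha n)
  have hS0 : ∀ n, 0 ≤ S n := fun n => hSmono (Nat.zero_le n)
  have haS : ∀ n m, n < m → a n ≤ S m := fun n m hnm =>
    (show a n ≤ S (n + 1) by rw [hS]; exact le_add_of_nonneg_left (hS0 n)).trans (hSmono hnm)
  have hsum : Summable fun n => ((1 : ℝ) / 2) ^ n • a n := by
    refine Summable.of_norm_bounded (g := fun n => ((1 : ℝ) / 2) ^ n * M)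
      (summable_geometric_two.mul_right M) fun n => ?_
    rw [norm_smul, Real.norm_of_nonneg (by positivity)]
    exact mul_le_mul_of_nonneg_left (haM n) (by positivity)
  set y := ∑' n, ((1 : ℝ) / 2) ^ n • a n with hy
  have hay : ∀ n, ((1 : ℝ) / 2) ^ n • a n ≤ y := fun n =>
    hsum.le_tsum n fun j _ => smul_nonneg (by positivity) (ha j)
  have hy0 : 0 ≤ y := (smul_nonneg (by positivity) (ha 0)).trans (hay 0)
  -- For `n < m`, `4⁻ᵐ a m ≤ 2⁻ⁿ y` and `a n ≤ S m`, so `v n ≤ (a n - 4⁻ᵐ a m)⁺` and `v m ≤ (a m -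
  -- 4ᵐ a n)⁺`, which are disjoint. Removing `2⁻ⁿ y` costs each functional at most `2⁻ⁿ C ‖y‖`.
  let v : ℕ → E := fun n => (a n - (4 : ℝ) ^ n • S n - ((1 : ℝ) / 2) ^ n • y)⁺
  have hv0 : ∀ n, 0 ≤ v n := fun n => posPart_nonneg _
  have h4S : ∀ n, 0 ≤ (4 : ℝ) ^ n • S n := fun n => smul_nonneg (by positivity) (hS0 n)
  have h2y : ∀ n : ℕ, 0 ≤ ((1 : ℝ) / 2) ^ n • y := fun n => smul_nonneg (by positivity) hy0
  have hva : ∀ n, v n ≤ a n := fun n =>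
    sup_le ((sub_le_self _ (h2y n)).trans (sub_le_self _ (h4S n))) (ha n)
  have hdisj : IsDisjointSeq v := by
    refine isDisjointSeq_of_nonneg hv0 fun n m hnm => ?_
    refine le_trans (inf_le_inf ?_ ?_)
      (posPart_sub_smul_inf_le (a m) (a n) (c := (4 : ℝ) ^ m) (one_le_pow₀ (by norm_num)))
    · refine posPart_mono ?_
      have h1 : ((4 : ℝ) ^ m)⁻¹ • a m ≤ ((1 : ℝ) / 2) ^ n • y := by
        calc ((4 : ℝ) ^ m)⁻¹ • a m ≤ (((1 : ℝ) / 2) ^ n * ((1 : ℝ) / 2) ^ m) • a m := by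
              refine smul_le_smul_of_nonneg_right ?_ (ha m)
              have : ((4 : ℝ) ^ m)⁻¹ = ((1 : ℝ) / 2) ^ m * ((1 : ℝ) / 2) ^ m := by
                rw [← mul_pow, ← inv_pow]; norm_num
              rw [this]
              exact mul_le_mul_of_nonneg_right
                (pow_le_pow_of_le_one (by norm_num) (by norm_num) hnm.le) (by positivity)
          _ = ((1 : ℝ) / 2) ^ n • ((1 : ℝ) / 2) ^ m • a m := by rw [smul_smul]
          _ ≤ _ := smul_le_smul_of_nonneg_left (hay m) (by positivity)
      calc a n - (4 : ℝ) ^ n • S n - ((1 : ℝ) / 2) ^ n • y ≤ a n - ((1 : ℝ) / 2) ^ n • y :=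
            sub_le_sub_right (sub_le_self _ (h4S n)) _
        _ ≤ _ := sub_le_sub_left h1 _
    · refine posPart_mono ((sub_le_self _ (h2y m)).trans (sub_le_sub_left ?_ _))
      exact smul_le_smul_of_nonneg_left (haS n m hnm) (by positivity)
  have hnull := H v hv0 (fun n => ⟨X ((4 : ℝ) ^ n • S n), hXA _, by
    rw [abs_of_nonneg (hv0 n)]; exact hva n⟩) hdisj (ε / 2) (half_pos hε)
  have hlim : Tendsto (fun n : ℕ => ((1 : ℝ) / 2) ^ n * (C * ‖y‖)) atTop (𝓝 0) := by
    simpa using (tendsto_pow_atTop_nhds_zero_of_lt_one (r := (1 : ℝ) / 2) (by norm_num)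
      (by norm_num)).mul_const (C * ‖y‖)
  obtain ⟨n, hn1, hn2⟩ := (hnull.and (hlim.eventually_lt_const (half_pos hε))).exists
  have h1 := hI ((4 : ℝ) ^ n • S n)
  rw [abs_of_nonneg (h4S n)] at h1
  have h2 : (|X ((4 : ℝ) ^ n • S n)| - (4 : ℝ) ^ n • S n)⁺ ≤ v n + ((1 : ℝ) / 2) ^ n • y := by
    refine sup_le ?_ (add_nonneg (hv0 n) (h2y n))
    rw [← sub_le_iff_le_add]
    exact le_posPart _
  have h3 := dual_monotone (hg (I ((4 : ℝ) ^ n • S n))) h2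
  rw [map_add, map_smul, smul_eq_mul] at h3
  have h4 := mul_le_mul_of_nonneg_left
    (apply_le_mul (hC (I ((4 : ℝ) ^ n • S n))) y) (show 0 ≤ ((1 : ℝ) / 2) ^ n by positivity)
  have h5 := hn1 (I ((4 : ℝ) ^ n • S n))
  linarith

/-- Order bounded increasing sequences are uniformly Cauchy if order bounded disjoint sequences
are uniformly null. -/
theorem exists_forall_apply_sub_le [IsOrderedModule ℝ E] {g : ι → StrongDual ℝ E}
    (hg : ∀ i, 0 ≤ g i) {C : ℝ} (hC : ∀ i, ‖g i‖ ≤ C) {w : E} (hw : 0 ≤ w)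
    (H : ∀ v : ℕ → E, (∀ n, 0 ≤ v n) → (∀ n, v n ≤ w) → IsDisjointSeq v → IsUniformlyNull g v)
    {s : ℕ → E} (hs : Monotone s) (hs0 : ∀ n, 0 ≤ s n) (hsw : ∀ n, s n ≤ w)
    {ε : ℝ} (hε : 0 < ε) :
    ∃ n, ∀ m, n ≤ m → ∀ i, g i (s m - s n) ≤ ε := by
  by_contra! hcon
  choose M hM I hI using hcon
  -- Iterating the bad index yields a subsequence each of whose increments is large for some
  -- functional.
  let K : ℕ → ℕ := fun k => M^[k] 0
  have hK : ∀ k, K (k + 1) = M (K k) := fun k => Function.iterate_succ_apply' M k 0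
  have hKmono : Monotone K := monotone_nat_of_le_succ fun k => by rw [hK]; exact hM _
  let r : ℕ → E := fun k => s (K k)
  have hr : Monotone r := hs.comp hKmono
  have hrI : ∀ k, ε < g (I (K k)) (r (k + 1) - r k) := fun k => by
    have := hI (K k); rwa [← hK] at this
  -- The interval `[0, w]` is cut into `N` levels of height `e = w / N`, so that `g i (2 • e) < ε /
  -- 2` for all `i`.
  obtain ⟨N, hN⟩ := exists_nat_gt (2 * (C * ‖w‖) / (ε / 2))
  have hCw : 0 ≤ C * ‖w‖ :=
    mul_nonneg ((norm_nonneg _).trans (hC (I 0))) (norm_nonneg _)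
  have hN0 : (0 : ℝ) < N := lt_of_le_of_lt (by positivity) hN
  set e : E := (N : ℝ)⁻¹ • w with he
  have he0 : 0 ≤ e := smul_nonneg (by positivity) hw
  have hNe : N • e = w := by
    rw [he, ← Nat.cast_smul_eq_nsmul ℝ, smul_smul, mul_inv_cancel₀ hN0.ne', one_smul]
  have hnull : ∀ j ∈ Finset.range N, ∀ᶠ k in atTop, ∀ i,
      g i ((r (k + 1) - (0 + j • e))⁺ ⊓ ((0 + j • e) - r k)⁺) ≤ ε / 2 / N := by
    intro j _
    have htj : 0 ≤ 0 + j • e := by rw [zero_add]; exact nsmul_nonneg he0 j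
    refine H (fun k => (r (k + 1) - (0 + j • e))⁺ ⊓ ((0 + j • e) - r k)⁺)
      (fun k => le_inf (posPart_nonneg _) (posPart_nonneg _))
      (fun k => inf_le_left.trans (sup_le ((sub_le_self _ htj).trans (hsw _)) hw)) ?_ _
      (by positivity)
    -- An increasing sequence crosses a fixed level once: for `k < l`, `r l ≥ r (k + 1)`, so both
    -- terms are controlled by opposite parts of `r (k + 1)` minus the level.
    refine isDisjointSeq_of_nonneg (fun k => le_inf (posPart_nonneg _) (posPart_nonneg _))
      fun k l hkl => ?_
    calc _ ≤ (r (k + 1) - (0 + j • e))⁺ ⊓ ((0 + j • e) - r l)⁺ :=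
          inf_le_inf inf_le_left inf_le_right
      _ ≤ (r (k + 1) - (0 + j • e))⁺ ⊓ ((0 + j • e) - r (k + 1))⁺ :=
          inf_le_inf_left _ (posPart_mono (sub_le_sub_left (hr hkl) _))
      _ = (r (k + 1) - (0 + j • e))⁺ ⊓ (r (k + 1) - (0 + j • e))⁻ := by
          rw [← posPart_neg (r (k + 1) - (0 + j • e)), neg_sub]
      _ ≤ 0 := (posPart_inf_negPart_eq_zero _).le
  obtain ⟨k, hk⟩ := ((Finset.eventually_all _).2 hnull).exists
  have h1 := sub_le_two_nsmul_add_sum (r (k + 1)) (r k) 0 e he0 N (hr (Nat.le_succ k)) (hs0 _)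
    (by rw [zero_add, hNe]; exact hsw _)
  have h2 := dual_monotone (hg (I (K k))) h1
  rw [map_add, map_sum, map_nsmul, he, map_smul, smul_eq_mul, nsmul_eq_mul] at h2
  have h3 : ∑ j ∈ Finset.range N,
      g (I (K k)) ((r (k + 1) - (0 + j • e))⁺ ⊓ ((0 + j • e) - r k)⁺) ≤ ε / 2 := by
    calc _ ≤ ∑ j ∈ Finset.range N, ε / 2 / N := Finset.sum_le_sum fun j hj => hk j hj _
      _ = ε / 2 := by rw [Finset.sum_const, Finset.card_range, nsmul_eq_mul]; field_simp
  have h4 : (2 : ℕ) * ((N : ℝ)⁻¹ * g (I (K k)) w) < ε / 2 := by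
    have h5 := apply_le_mul (hC (I (K k))) w
    have h6 : (N : ℝ)⁻¹ * g (I (K k)) w ≤ (N : ℝ)⁻¹ * (C * ‖w‖) :=
      mul_le_mul_of_nonneg_left h5 (by positivity)
    have h7 : 2 * ((N : ℝ)⁻¹ * (C * ‖w‖)) < ε / 2 := by
      rw [div_lt_iff₀ (by positivity)] at hN
      calc 2 * ((N : ℝ)⁻¹ * (C * ‖w‖)) = (N : ℝ)⁻¹ * (2 * (C * ‖w‖)) := by ring
        _ < (N : ℝ)⁻¹ * (N * (ε / 2)) := mul_lt_mul_of_pos_left hN (by positivity)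
        _ = ε / 2 := by field_simp
    push_cast
    linarith
  have h8 := hrI k
  linarith

end Uniform

/-! ### Finite control of a family of functionals -/

section Control

variable {E : Type*} [NormedAddCommGroup E] [NormedSpace ℝ E] [Lattice E] [IsOrderedAddMonoid E]
  {ι : Type*}

theorem apply_partialSups_le_sum {g : StrongDual ℝ E} (hg : 0 ≤ g) {d : ℕ → E}
    (hd : ∀ n, 0 ≤ d n) (n : ℕ) : g (partialSups d n) ≤ ∑ k ∈ Finset.range (n + 1), g (d k) := by
  rw [← map_sum]
  refine dual_monotone hg (partialSups_le _ _ _ fun k hk => ?_)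
  exact Finset.single_le_sum (fun j _ => hd j) (Finset.mem_range.2 (Nat.lt_succ_of_le hk))

/-- On an order interval whose disjoint sequences are uniformly null, the family `g` is uniformly
absolutely continuous with respect to a finite sum of its members. -/
theorem exists_finset_control [IsOrderedModule ℝ E] {g : ι → StrongDual ℝ E}
    (hg : ∀ i, 0 ≤ g i) {C : ℝ} (hC : ∀ i, ‖g i‖ ≤ C) {w : E} (hw : 0 ≤ w)
    (H : ∀ v : ℕ → E, (∀ n, 0 ≤ v n) → (∀ n, v n ≤ w) → IsDisjointSeq v → IsUniformlyNull g v)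
    {η : ℝ} (hη : 0 < η) :
    ∃ F : Finset ι, ∃ δ : ℝ, 0 < δ ∧ ∀ d, 0 ≤ d → d ≤ w → ∑ i ∈ F, g i d < δ → ∀ i, g i d ≤ η := by
  classical
  by_contra! hcon
  have hcon' : ∀ (F : Finset ι) (n : ℕ), ∃ d, 0 ≤ d ∧ d ≤ w ∧ ∑ i ∈ F, g i d < (1 / 2 : ℝ) ^ n ∧
      ∃ i, η < g i d := fun F n => hcon F _ (by positivity)
  choose D hD0 hDw hDs I hI using hcon'
  -- The set `F n` collects the earlier indices `q k`, so `d n` is below `2⁻ⁿ` for all of them while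
  -- `g (q n) (d n) > η`.
  let F : ℕ → Finset ι := fun n => Nat.rec ∅ (fun n s => insert (I s n) s) n
  have hF : ∀ n, F (n + 1) = insert (I (F n) n) (F n) := fun n => rfl
  have hFmono : Monotone F := monotone_nat_of_le_succ fun n => by
    rw [hF]; exact Finset.subset_insert _ _
  let d : ℕ → E := fun n => D (F n) n
  let q : ℕ → ι := fun n => I (F n) n
  have hd0 : ∀ n, 0 ≤ d n := fun n => hD0 _ _
  have hdw : ∀ n, d n ≤ w := fun n => hDw _ _
  have hqF : ∀ n m, n < m → q n ∈ F m := fun n m hnm =>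
    hFmono hnm (by rw [hF]; exact Finset.mem_insert_self _ _)
  have hqd : ∀ n m, n < m → g (q n) (d m) ≤ (1 / 2 : ℝ) ^ m := fun n m hnm =>
    (Finset.single_le_sum (f := fun i => g i (d m)) (fun i _ => hg i _ (hd0 m))
      (hqF n m hnm)).trans (hDs _ _).le
  -- No suprema need exist in `E`: `b n` stands in for the supremum of `d k` over `k ≥ n`, and the
  -- decreasing `t n` for the limit superior. Then `g (q n)` is small on `t m` for large `m`, hence
  -- on `t n`, `b n` and `d n`, against the choice of `q n`.
  let s : ℕ → ℕ → E := fun n => partialSups fun k => d (n + k)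
  have hsmono : ∀ n, Monotone (s n) := fun n => (partialSups fun k => d (n + k)).monotone
  have hs0 : ∀ n m, 0 ≤ s n m := fun n m =>
    (hd0 (n + 0)).trans (le_partialSups_of_le (fun k => d (n + k)) (Nat.zero_le m))
  have hsw : ∀ n m, s n m ≤ w := fun n m => partialSups_le _ _ _ fun k _ => hdw _
  have hm : ∀ n, ∃ M, ∀ m, M ≤ m → ∀ i, g i (s n m - s n M) ≤ η / 8 * (1 / 2) ^ n := fun n =>
    exists_forall_apply_sub_le hg hC hw H (hsmono n) (hs0 n) (hsw n) (by positivity)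
  choose M hM using hm
  let b : ℕ → E := fun n => s n (M n)
  let t : ℕ → E := fun n => (Finset.range (n + 1)).inf' Finset.nonempty_range_add_one b
  have ht0 : ∀ n, 0 ≤ t n := fun n => Finset.le_inf' _ _ fun k _ => hs0 _ _
  have htb : ∀ n, t n ≤ b n := fun n => Finset.inf'_le _ (Finset.self_mem_range_succ n)
  have htanti : Antitone t := fun n m hnm =>
    Finset.inf'_mono _ (Finset.range_mono (Nat.succ_le_succ hnm)) _
  obtain ⟨n, hn⟩ := exists_forall_apply_sub_le hg hC hw H (s := fun n => w - t n)
    (fun n m hnm => sub_le_sub_left (htanti hnm) _)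
    (fun n => sub_nonneg.2 ((htb n).trans (hsw _ _))) (fun n => sub_le_self _ (ht0 n))
    (show 0 < η / 8 by positivity)
  have hbt : ∀ i, g i (b n) ≤ g i (t n) + η / 4 := by
    intro i
    let L : ℕ := n + M n + ∑ k ∈ Finset.range (n + 1), M k
    have hML : ∀ k ∈ Finset.range (n + 1), M k ≤ L := fun k hk =>
      (Finset.single_le_sum (f := M) (fun j _ => Nat.zero_le _) hk).trans (Nat.le_add_left _ _)
    have hnn : ∀ k ∈ Finset.range (n + 1), 0 ≤ s k L - b k := fun k hk =>
      sub_nonneg.2 (hsmono k (hML k hk))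
    -- For each `k ≤ n`, `b n ≤ s k L`, and `s k L` exceeds `b k` by only `η / 8 * 2⁻ᵏ` under each
    -- functional; these errors sum to at most `η / 4`.
    have h1 : b n - ∑ k ∈ Finset.range (n + 1), (s k L - b k) ≤ t n := by
      refine Finset.le_inf' _ _ fun k hk => ?_
      have h2 : b n ≤ s k L := by
        refine partialSups_le _ _ _ fun j hj => ?_
        have hkn : k ≤ n := Nat.lt_succ_iff.1 (Finset.mem_range.1 hk)
        have hle : d (k + (n + j - k)) ≤ s k L :=
          le_partialSups_of_le (fun l => d (k + l)) (by omega)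
        rwa [show k + (n + j - k) = n + j by omega] at hle
      have h3 := Finset.single_le_sum (f := fun k => s k L - b k) hnn hk
      calc _ ≤ s k L - (s k L - b k) := sub_le_sub h2 h3
        _ = b k := by abel
    have h2 := dual_monotone (hg i) h1
    rw [map_sub, map_sum] at h2
    have h3 : ∑ k ∈ Finset.range (n + 1), g i (s k L - b k) ≤ η / 4 := by
      calc _ ≤ ∑ k ∈ Finset.range (n + 1), η / 8 * (1 / 2 : ℝ) ^ k :=
            Finset.sum_le_sum fun k hk => hM k L (hML k hk) i
        _ = η / 8 * ∑ k ∈ Finset.range (n + 1), (1 / 2 : ℝ) ^ k := by rw [Finset.mul_sum]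
        _ ≤ η / 8 * 2 := mul_le_mul_of_nonneg_left (sum_geometric_two_le _) (by positivity)
        _ = η / 4 := by ring
    linarith
  have htm : ∀ m, n < m → g (q n) (t m) ≤ 2 * (1 / 2 : ℝ) ^ m := by
    intro m hnm
    calc g (q n) (t m) ≤ g (q n) (b m) := dual_monotone (hg _) (htb m)
      _ ≤ ∑ k ∈ Finset.range (M m + 1), g (q n) (d (m + k)) :=
          apply_partialSups_le_sum (hg _) (fun k => hd0 _) _
      _ ≤ ∑ k ∈ Finset.range (M m + 1), (1 / 2 : ℝ) ^ m * (1 / 2 : ℝ) ^ k :=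
          Finset.sum_le_sum fun k _ => (hqd n (m + k) (by omega)).trans_eq (pow_add _ _ _)
      _ = (1 / 2 : ℝ) ^ m * ∑ k ∈ Finset.range (M m + 1), (1 / 2 : ℝ) ^ k := by
          rw [Finset.mul_sum]
      _ ≤ (1 / 2 : ℝ) ^ m * 2 :=
          mul_le_mul_of_nonneg_left (sum_geometric_two_le _) (by positivity)
      _ = _ := mul_comm _ _
  have hlim : Tendsto (fun m : ℕ => 2 * (1 / 2 : ℝ) ^ m) atTop (𝓝 0) := by
    simpa using (tendsto_pow_atTop_nhds_zero_of_lt_one (r := (1 : ℝ) / 2) (by norm_num)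
      (by norm_num)).const_mul 2
  obtain ⟨m, hm1, hm2⟩ := ((hlim.eventually_lt_const (show 0 < η / 8 by positivity)).and
    (eventually_gt_atTop n)).exists
  have h1 : η < g (q n) (d n) := hI _ _
  have h2 : g (q n) (d n) ≤ g (q n) (b n) := dual_monotone (hg _)
    (le_partialSups_of_le (fun k => d (n + k)) (Nat.zero_le (M n)))
  have h3 := hbt (q n)
  have h4 := hn m hm2.le (q n)
  rw [sub_sub_sub_cancel_left, map_sub] at h4
  have h5 := htm m hm2
  linarith

end Control

/-! ### Convex blocks in an order interval -/

section ConvexBlocks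

theorem exists_mem_convexHull_image_Iio {V : Type*} [AddCommGroup V] [Module ℝ V] {x : ℕ → V}
    {n : ℕ} {a : V} (ha : a ∈ convexHull ℝ (x '' Set.Ici n)) :
    ∃ m, n ≤ m ∧ a ∈ convexHull ℝ (x '' Set.Iio m) := by
  classical
  rw [convexHull_eq_union_convexHull_finite_subsets] at ha
  simp only [Set.mem_iUnion] at ha
  obtain ⟨t, ht, hat⟩ := ha
  obtain ⟨s, -, rfl⟩ := Finset.subset_set_image_iff.1 ht
  refine ⟨max n (s.sup id + 1), le_max_left _ _, convexHull_mono ?_ hat⟩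
  rw [Finset.coe_image]
  refine Set.image_mono fun k hk => ?_
  exact lt_of_lt_of_le (Nat.lt_succ_of_le (Finset.le_sup (f := id) hk)) (le_max_right _ _)

variable {E : Type*} [NormedAddCommGroup E] [NormedSpace ℝ E] [Lattice E] [IsOrderedAddMonoid E]
  [IsOrderedModule ℝ E]

theorem abs_le_of_mem_convexHull {V : Type*} [AddCommGroup V] [Module ℝ V] (L : V →ₗ[ℝ] E)
    {s : Set V} {u : E} (hs : ∀ x ∈ s, |L x| ≤ u) {a : V} (ha : a ∈ convexHull ℝ s) :
    |L a| ≤ u := by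
  have h : convexHull ℝ s ⊆ L ⁻¹' Set.Icc (-u) u :=
    convexHull_min (fun x hx => ⟨neg_le.1 (abs_le'.1 (hs x hx)).2, (abs_le'.1 (hs x hx)).1⟩)
      ((convex_Icc _ _).linear_preimage L)
  exact abs_le'.2 ⟨(h ha).2, neg_le.1 (h ha).1⟩

omit [IsOrderedAddMonoid E] in
theorem smul_abs_le (z : E) {c : ℝ} (hc : 0 < c) : c • |z| ≤ |c • z| := by
  rw [← le_inv_smul_iff_of_pos hc]
  refine abs_le'.2 ⟨?_, ?_⟩ <;> rw [le_inv_smul_iff_of_pos hc]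
  · exact le_abs_self _
  · rw [smul_neg]; exact neg_le_abs _

/-- A sequence in an order interval has successive convex blocks that are close to each other in
the seminorm `x ↦ g |x|`. -/
theorem exists_convexHull_apply_abs_sub_le {V : Type*} [AddCommGroup V] [Module ℝ V]
    (L : V →ₗ[ℝ] E) (x : ℕ → V) {u : E} (hu : 0 ≤ u) (hx : ∀ n, |L (x n)| ≤ u)
    {g : StrongDual ℝ E} (hg : 0 ≤ g) {δ : ℝ} (hδ : 0 < δ) :
    ∃ m, ∃ a ∈ convexHull ℝ (x '' Set.Iio m), ∃ b ∈ convexHull ℝ (x '' Set.Ici m),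
      g |L a - L b| ≤ δ := by
  have hgu : 0 ≤ g u := hg u hu
  obtain ⟨N, hN⟩ := exists_nat_gt (4 * g u / (δ / 2))
  have hN0 : (0 : ℝ) < N := lt_of_le_of_lt (by positivity) hN
  set e : E := (2 / (N : ℝ)) • u with he
  have he0 : 0 ≤ e := smul_nonneg (by positivity) hu
  have hNe : N • e = 2 • u := by
    rw [he, ← Nat.cast_smul_eq_nsmul ℝ, smul_smul, mul_div_cancel₀ _ hN0.ne', ofNat_smul_eq_nsmul]
  have hge : 2 * g e ≤ δ / 2 := by
    rw [he, map_smul, smul_eq_mul]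
    rw [div_lt_iff₀ (by positivity)] at hN
    have : 2 * (2 / (N : ℝ) * g u) = 4 * g u / N := by ring
    rw [this, div_le_iff₀ hN0]
    linarith
  let t : ℕ → E := fun j => -u + j • e
  -- The levels `t j` fill `[-u, u]`. Summing the slack of the triangle inequality over them makes
  -- `Φ` uniformly convex for the seminorm `g |L ·|`, up to the error `4 * g e`.
  let Φ : V → ℝ := fun v => ∑ j ∈ Finset.range N, g |L v - t j|
  have hΦ0 : ∀ v, 0 ≤ Φ v := fun v => Finset.sum_nonneg fun j _ => hg _ (abs_nonneg _)
  have hgap : ∀ a b : V, |L a| ≤ u → |L b| ≤ u →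
      2 * Φ ((1 / 2 : ℝ) • a + (1 / 2 : ℝ) • b) + 2 * g |L a - L b| ≤ Φ a + Φ b + 4 * g e := by
    intro a b ha hb
    have h1 := sub_le_two_nsmul_add_sum (L a ⊔ L b) (L a ⊓ L b) (-u) e he0 N
      (inf_le_left.trans le_sup_left)
      (le_inf (neg_le.1 (abs_le'.1 ha).2) (neg_le.1 (abs_le'.1 hb).2))
      (by
        rw [hNe, two_nsmul, neg_add_cancel_left]
        exact sup_le (abs_le'.1 ha).1 (abs_le'.1 hb).1)
    rw [sup_sub_inf_eq_abs_sub, abs_sub_comm] at h1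
    have h2 := dual_monotone hg h1
    rw [map_add, map_sum, map_nsmul, nsmul_eq_mul] at h2
    have h3 : 2 * Φ ((1 / 2 : ℝ) • a + (1 / 2 : ℝ) • b) + 2 * ∑ j ∈ Finset.range N,
        g ((L a ⊔ L b - (-u + j • e))⁺ ⊓ ((-u + j • e) - L a ⊓ L b)⁺) ≤ Φ a + Φ b := by
      simp only [Φ]
      rw [Finset.mul_sum, Finset.mul_sum, ← Finset.sum_add_distrib, ← Finset.sum_add_distrib]
      refine Finset.sum_le_sum fun j _ => ?_
      have h4 := dual_monotone hg (abs_add_add_two_nsmul_le (L a) (L b) (t j))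
      rw [map_add, map_add, map_nsmul, nsmul_eq_mul] at h4
      have h5 : L a + L b - 2 • t j =
          (2 : ℝ) • (L ((1 / 2 : ℝ) • a + (1 / 2 : ℝ) • b) - t j) := by
        rw [map_add, map_smul, map_smul, ← smul_add, smul_sub, smul_smul,
          ← ofNat_smul_eq_nsmul ℝ 2]
        norm_num
      have h6 := dual_monotone hg
        (smul_abs_le (L ((1 / 2 : ℝ) • a + (1 / 2 : ℝ) • b) - t j) (two_pos (α := ℝ)))
      rw [h5] at h4
      rw [map_smul, smul_eq_mul] at h6
      push_cast at h4
      linarith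
    push_cast at h2
    linarith
  let A : ℕ → Set V := fun n => convexHull ℝ (x '' Set.Ici n)
  have hAanti : ∀ n m, n ≤ m → A m ⊆ A n := fun n m hnm =>
    convexHull_mono (Set.image_mono (Set.Ici_subset_Ici.2 hnm))
  have hxA : ∀ n, x n ∈ A n := fun n => subset_convexHull ℝ _ ⟨n, Set.self_mem_Ici, rfl⟩
  have hAu : ∀ n, ∀ a ∈ A n, |L a| ≤ u := fun n a ha =>
    abs_le_of_mem_convexHull L (by rintro _ ⟨k, -, rfl⟩; exact hx k) ha
  let α : ℕ → ℝ := fun n => sInf (Φ '' A n)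
  have hbdd : ∀ n, BddBelow (Φ '' A n) := fun n => ⟨0, by rintro _ ⟨v, -, rfl⟩; exact hΦ0 v⟩
  have hαle : ∀ n, ∀ a ∈ A n, α n ≤ Φ a := fun n a ha => csInf_le (hbdd n) ⟨a, ha, rfl⟩
  have hαbdd : BddAbove (Set.range α) := by
    refine ⟨∑ j ∈ Finset.range N, g (u + |t j|), ?_⟩
    rintro _ ⟨n, rfl⟩
    refine (hαle n _ (hxA n)).trans (Finset.sum_le_sum fun j _ => dual_monotone hg ?_)
    rw [sub_eq_add_neg]
    refine (abs_add_le _ _).trans ?_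
    rw [abs_neg]
    gcongr
    exact hx n
  have hαex : ∀ n, ∃ a ∈ A n, Φ a < α n + δ / 4 := by
    intro n
    obtain ⟨_, ⟨a, ha, rfl⟩, h⟩ := exists_lt_of_csInf_lt
      (⟨_, x n, hxA n, rfl⟩ : (Φ '' A n).Nonempty) (lt_add_of_pos_right (α n)
        (show 0 < δ / 4 by positivity))
    exact ⟨a, ha, h⟩
  -- With `α n` nearly maximal, near-minimizers `a` in `A n` and `b` in a later hull have almost the
  -- same `Φ`. Their midpoint stays in `A n`, so `Φ` cannot drop there and the convexity gain is
  -- small.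
  obtain ⟨n, hn⟩ := exists_lt_of_lt_ciSup (sub_lt_self (iSup α) (show 0 < δ / 4 by positivity))
  obtain ⟨a, ha, haΦ⟩ := hαex n
  obtain ⟨m, hnm, ham⟩ := exists_mem_convexHull_image_Iio ha
  obtain ⟨b, hb, hbΦ⟩ := hαex m
  refine ⟨m, a, ham, b, hb, ?_⟩
  have hmid : (1 / 2 : ℝ) • a + (1 / 2 : ℝ) • b ∈ A n :=
    convex_convexHull ℝ _ ha (hAanti n m hnm hb) (by norm_num) (by norm_num) (by norm_num)
  have h1 := hαle n _ hmid
  have h2 := hgap a b (hAu n a ha) (hAu m b hb)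
  have h3 : α m ≤ iSup α := le_ciSup hαbdd m
  linarith

end ConvexBlocks

/-! ### A James-type criterion for weak compactness -/

section WeakCompactness

variable {X : Type*} [NormedAddCommGroup X] [NormedSpace ℝ X] [CompleteSpace X]

/-- A bounded convex set of a Banach space is relatively weakly compact if each of its sequences
has successive convex blocks that are close to each other. -/
theorem isCompact_closure_of_convexHull_close {C : Set X} (hconv : Convex ℝ C)
    (hb : Bornology.IsBounded C)
    (H : ∀ a : ℕ → X, (∀ n, a n ∈ C) → ∀ ε : ℝ, 0 < ε →
      ∃ m, ∃ y ∈ convexHull ℝ (a '' Set.Iio m), ∃ z ∈ convexHull ℝ (a '' Set.Ici m), ‖y - z‖ < ε) :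
    IsCompact (closure (toWeakSpace ℝ X '' C)) := by
  classical
  refine NormedSpace.isCompact_closure_of_isBounded ℝ X _
    (by rwa [Set.preimage_image_eq _ (toWeakSpace ℝ X).injective]) fun φ hφ => ?_
  let ψ : StrongDual ℝ (StrongDual ℝ X) := WeakDual.toStrongDual φ
  have happrox : ∀ (F : Finset (StrongDual ℝ X)) (ε : ℝ), 0 < ε →
      ∃ x ∈ C, ∀ f ∈ F, |ψ f - f x| < ε := by
    intro F ε hε
    have hU : {χ : WeakDual ℝ (StrongDual ℝ X) | ∀ f ∈ F, |φ f - χ f| < ε} ∈ 𝓝 φ := by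
      refine (Finset.eventually_all F).2 fun f _ => ?_
      have hc : Continuous fun χ : WeakDual ℝ (StrongDual ℝ X) => |φ f - χ f| :=
        (continuous_const.sub (WeakDual.eval_continuous f)).abs
      exact hc.continuousAt.eventually_lt_const (by simpa using hε)
    obtain ⟨_, hχ, ⟨_, ⟨x, hx, rfl⟩, rfl⟩⟩ := mem_closure_iff_nhds.1 hφ _ hU
    exact ⟨x, hx, hχ⟩
  have hclaim : ∀ ε : ℝ, 0 < ε → ∃ y ∈ C, ∀ f : StrongDual ℝ X, ‖f‖ ≤ 1 → |ψ f - f y| ≤ ε := by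
    intro ε hε
    by_contra! hcon
    -- The hull of a finite set is compact, so finitely many functionals keep `ψ` away from all of
    -- it, at the price of halving `ε`.
    have hG : ∀ P : Finset X, ∃ G : Finset (StrongDual ℝ X), (P : Set X) ⊆ C →
        (∀ f ∈ G, ‖f‖ ≤ 1) ∧ ∀ y ∈ convexHull ℝ (P : Set X), ∃ f ∈ G, ε / 2 < |ψ f - f y| := by
      intro P
      by_cases hP : (P : Set X) ⊆ C
      · have hcomp : IsCompact (convexHull ℝ (P : Set X)) := P.finite_toSet.isCompact_convexHull ℝ
        obtain ⟨G, hG, hG'⟩ := hcomp.elim_finite_subcover_image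
          (b := {f : StrongDual ℝ X | ‖f‖ ≤ 1}) (c := fun f => {y | ε / 2 < |ψ f - f y|})
          (fun f _ => isOpen_lt continuous_const (continuous_const.sub f.continuous).abs)
          (fun y hy => by
            obtain ⟨f, hf, hfy⟩ := hcon y (convexHull_min hP hconv hy)
            exact Set.mem_biUnion hf (show ε / 2 < |ψ f - f y| by linarith))
        refine ⟨hG'.1.toFinset, fun _ => ⟨fun f hf => hG (by simpa using hf), fun y hy => ?_⟩⟩
        obtain ⟨f, hf, hfy⟩ := Set.mem_iUnion₂.1 (hG'.2 hy)
        exact ⟨f, by simpa using hf, hfy⟩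
      · exact ⟨∅, fun h => absurd h hP⟩
    choose G hG using hG
    -- Ranging over all subsets of `P` makes each new point respect the functionals of every earlier
    -- stage. Some such functional then separates a block of earlier points from every block of
    -- later ones by more than `ε / 4`.
    have hnext : ∀ P : Finset X, ∃ x ∈ C, ∀ f ∈ P.powerset.biUnion G, |ψ f - f x| < ε / 4 :=
      fun P => happrox _ _ (by positivity)
    choose next hnextC hnext using hnext
    let P : ℕ → Finset X := fun n => Nat.rec ∅ (fun _ s => insert (next s) s) n
    have hPs : ∀ n, P (n + 1) = insert (next (P n)) (P n) := fun n => rfl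
    have hPmono : Monotone P := monotone_nat_of_le_succ fun n => by
      rw [hPs]; exact Finset.subset_insert _ _
    have hPC : ∀ n : ℕ, SetLike.coe (P n) ⊆ C := by
      intro n
      induction n with
      | zero => intro x hx; simp [P] at hx
      | succ n ih => rw [hPs, Finset.coe_insert]; exact Set.insert_subset (hnextC _) ih
    let a : ℕ → X := fun n => next (P n)
    obtain ⟨m, y, hy, z, hz, hyz⟩ := H a (fun n => hnextC _) (ε / 4) (by positivity)
    have hyP : y ∈ convexHull ℝ (SetLike.coe (P m)) := by
      refine convexHull_mono ?_ hy
      rintro _ ⟨k, hk, rfl⟩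
      exact hPmono (Nat.succ_le_of_lt hk) (by rw [hPs]; exact Finset.mem_insert_self _ _)
    obtain ⟨hG1, hG2⟩ := hG (P m) (hPC m)
    obtain ⟨f, hf, hfy⟩ := hG2 y hyP
    have hfz : z ∈ f ⁻¹' Set.Icc (ψ f - ε / 4) (ψ f + ε / 4) := by
      refine convexHull_min ?_ ((convex_Icc _ _).linear_preimage f.toLinearMap) hz
      rintro _ ⟨k, hk, rfl⟩
      have h1 := hnext (P k) f (Finset.mem_biUnion.2
        ⟨P m, Finset.mem_powerset.2 (hPmono hk), hf⟩)
      rw [abs_lt] at h1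
      constructor
      · change ψ f - ε / 4 ≤ f (next (P k)); linarith
      · change f (next (P k)) ≤ ψ f + ε / 4; linarith
    have h2 : |f (y - z)| ≤ ‖y - z‖ := f.le_of_opNorm_le (hG1 f hf) _ |>.trans_eq (one_mul _)
    rw [map_sub] at h2
    have h3 := hfz.1
    have h4 := hfz.2
    have h5 := abs_le.1 (h2.trans hyz.le)
    rcases lt_abs.1 hfy with h | h <;> linarith [h5.1, h5.2]
  have hrange : ψ ∈ Set.range (NormedSpace.inclusionInDoubleDualLi (E := X) ℝ) := by
    have hcl := 
      (NormedSpace.inclusionInDoubleDualLi (E := X) ℝ).isometry.isUniformInducing.isComplete_range.isClosed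
    rw [← hcl.closure_eq]
    refine Metric.mem_closure_iff.2 fun ε hε => ?_
    obtain ⟨y, -, hy⟩ := hclaim (ε / 2) (by positivity)
    refine ⟨_, ⟨y, rfl⟩, ?_⟩
    rw [dist_eq_norm]
    refine lt_of_le_of_lt (ContinuousLinearMap.opNorm_le_of_unit_norm (by positivity)
      fun f hf => ?_) (half_lt_self hε)
    exact hy f hf.le
  obtain ⟨y, hy⟩ := hrange
  refine ⟨toWeakSpace ℝ X y, ?_⟩
  refine DFunLike.ext _ _ fun f => ?_
  exact congrArg (fun χ : StrongDual ℝ (StrongDual ℝ X) => χ f) hy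

end WeakCompactness

/-! ### Sums of disjoint positive elements -/

section DisjointElements

variable {E : Type*} [AddCommGroup E] [Lattice E] [IsOrderedAddMonoid E]

theorem sum_inf_eq_zero {ι : Type*} {a : ι → E} {b : E} (ha : ∀ i, 0 ≤ a i) (hb : 0 ≤ b)
    (s : Finset ι) (h : ∀ i ∈ s, a i ⊓ b = 0) : (∑ i ∈ s, a i) ⊓ b = 0 := by
  classical
  induction s using Finset.induction_on with
  | empty => simpa using hb
  | insert i s his ih =>
    rw [Finset.sum_insert his]
    have hs : 0 ≤ ∑ i ∈ s, a i := Finset.sum_nonneg fun i _ => ha i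
    refine le_antisymm ((inf_add_le_inf_add_inf (ha i) hs hb).trans ?_)
      (le_inf (add_nonneg (ha i) hs) hb)
    rw [h i (Finset.mem_insert_self _ _),
      ih fun j hj => h j (Finset.mem_insert_of_mem hj), add_zero]

theorem nsmul_inf_eq_zero {a b : E} (ha : 0 ≤ a) (hb : 0 ≤ b) (h : a ⊓ b = 0) (n : ℕ) :
    (n • a) ⊓ b = 0 := by
  simpa using sum_inf_eq_zero (a := fun _ : ℕ => a) (fun _ => ha) hb (Finset.range n)
    fun _ _ => h

theorem sum_le_of_pairwise_disjoint {ι : Type*} {a : ι → E} {z : E} (hz : 0 ≤ z)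
    (ha : ∀ i, 0 ≤ a i) (haz : ∀ i, a i ≤ z) (hdisj : Pairwise fun i j => a i ⊓ a j = 0)
    (s : Finset ι) : ∑ i ∈ s, a i ≤ z := by
  classical
  induction s using Finset.induction_on with
  | empty => simpa using hz
  | insert i s his ih =>
    rw [Finset.sum_insert his, ← inf_add_sup, inf_comm,
      sum_inf_eq_zero ha (ha i) s fun j hj => hdisj fun hji => his (hji ▸ hj), zero_add]
    exact sup_le (haz i) ih

end DisjointElements

/-! ### Order continuity of the dual norm and disjoint sequences -/

section OrderContinuity

variable {E : Type*} [NormedAddCommGroup E] [NormedSpace ℝ E] [Lattice E] [IsOrderedAddMonoid E]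
  [HasSolidNorm E]

/-- The parts of a positive functional carried by the bands generated by pairwise disjoint
positive elements. -/
theorem exists_bandParts {g : StrongDual ℝ E} (hg : 0 ≤ g) {ι : Type*} {y : ι → E}
    (hy : ∀ i, 0 ≤ y i) (hdisj : Pairwise fun i j => y i ⊓ y j = 0) :
    ∃ f : ι → StrongDual ℝ E, (∀ i, 0 ≤ f i) ∧ (∀ i, f i (y i) = g (y i)) ∧
      (∀ i j, i ≠ j → f i (y j) = 0) ∧
      ∀ (s : Finset ι) (z : E), 0 ≤ z → ∑ i ∈ s, f i z ≤ g z := by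
  choose f hf using fun i => exists_bandPart hg (hy i)
  have hky : ∀ i (k : ℕ), 0 ≤ k • y i := fun i k => nsmul_nonneg (hy i) k
  refine ⟨f, fun i z hz => ?_, fun i => le_antisymm ?_ ?_, fun i j hij => ?_, fun s z hz => ?_⟩
  · have h : 0 ≤ g (z ⊓ (0 • y i)) := hg _ (le_inf hz (hky i 0))
    exact h.trans ((hf i z hz).1 ⟨0, rfl⟩)
  · refine (isLUB_le_iff (hf i _ (hy i))).2 ?_
    rintro _ ⟨k, rfl⟩
    exact dual_monotone hg inf_le_left
  · have h := (hf i _ (hy i)).1 ⟨1, rfl⟩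
    simpa using h
  · refine (hf i _ (hy j)).unique ?_
    have h : (fun k : ℕ => g (y j ⊓ (k • y i))) = fun _ => 0 := funext fun k => by
      rw [inf_comm, nsmul_inf_eq_zero (hy i) (hy j) (hdisj hij), map_zero]
    rw [h, Set.range_const]
    exact isLUB_singleton
  · have hlim : ∀ i, Tendsto (fun k : ℕ => g (z ⊓ (k • y i))) atTop (𝓝 (f i z)) := fun i =>
      tendsto_atTop_isLUB (fun k l hkl => dual_monotone hg
        (inf_le_inf_left _ (nsmul_le_nsmul_left (hy i) hkl))) (hf i z hz)
    refine le_of_tendsto (tendsto_finsetSum s fun i _ => hlim i) (Eventually.of_forall fun k => ?_)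
    rw [← map_sum]
    refine dual_monotone hg (sum_le_of_pairwise_disjoint hz (fun i => le_inf hz (hky i k))
      (fun i => inf_le_left) (fun i j hij => ?_) s)
    refine le_antisymm ?_ (le_inf (le_inf hz (hky i k)) (le_inf hz (hky j k)))
    have h1 := nsmul_inf_eq_zero (hy i) (hy j) (hdisj hij) k
    rw [inf_comm] at h1
    have h2 := nsmul_inf_eq_zero (hy j) (hky i k) h1 k
    rw [← h2, inf_comm (k • y j)]
    exact inf_le_inf inf_le_right inf_le_right

omit [NormedSpace ℝ E] [IsOrderedAddMonoid E] [HasSolidNorm E] in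
theorem IsDisjointSeq.abs_inf_abs {x : ℕ → E} (hx : IsDisjointSeq x) :
    Pairwise fun i j => |x i| ⊓ |x j| = 0 := hx

/-- Let `g = |h|`, with band parts `f n` on `|x n|`. The tails `d n` of `∑ f k` decrease to `0`,
hence in norm, and `|h (x n)| ≤ g |x n| = f n |x n| ≤ d n |x n|`. -/
theorem isWeaklyNull_of_hasOrderContinuousNorm_dual
    (hE : HasOrderContinuousNorm (StrongDual ℝ E)) {x : ℕ → E}
    (hb : Bornology.IsBounded (Set.range x)) (hx : IsDisjointSeq x) : IsWeaklyNull x := by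
  refine (isWeaklyNull_iff x).2 fun h => ?_
  obtain ⟨g, hg, hgh⟩ := exists_modulus h
  obtain ⟨f, hf0, hfy, -, hfs⟩ := exists_bandParts hg (fun n => abs_nonneg (x n)) hx.abs_inf_abs
  obtain ⟨M, hM⟩ := isBounded_iff_forall_norm_le.1 hb
  have hM' : ∀ n, ‖|x n|‖ ≤ M := fun n => by rw [norm_abs_eq_norm]; exact hM _ ⟨n, rfl⟩
  have hsum : ∀ z : E, 0 ≤ z → Summable fun k => f k z := fun z hz =>
    summable_of_sum_le (fun k => hf0 k z hz) fun s => hfs s z hz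
  have htsum : ∀ z : E, 0 ≤ z → ∑' k, f k z ≤ g z := fun z hz =>
    (hsum z hz).tsum_le_of_sum_le fun s => hfs s z hz
  obtain ⟨F, hF⟩ := exists_dual_of_additive (fun z => ∑' k, f k z) ‖g‖
    (fun y z hy hz => by
      simp only [map_add]; exact (hsum y hy).tsum_add (hsum z hz))
    (fun z hz => by
      rw [abs_of_nonneg (tsum_nonneg fun k => hf0 k z hz)]
      exact (htsum z hz).trans (apply_le_mul le_rfl z))
  let d : ℕ → StrongDual ℝ E := fun n => F - ∑ k ∈ Finset.range n, f k
  have hd : ∀ n z, d n z = F z - ∑ k ∈ Finset.range n, f k z := fun n z => by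
    simp only [d, sub_apply, sum_apply]
  have hd0 : ∀ n, 0 ≤ d n := fun n z hz => by
    have h1 := (hsum z hz).sum_le_tsum (Finset.range n) fun k _ => hf0 k z hz
    have h2 := hd n z
    rw [hF z hz] at h2
    change 0 ≤ d n z
    linarith
  have hdanti : Antitone d := antitone_nat_of_succ_le fun n z hz => by
    rw [hd, hd, Finset.sum_range_succ]
    have := hf0 n z hz
    change 0 ≤ f n z at this
    linarith
  have hglb : IsGLB (Set.range d) 0 := by
    refine ⟨by rintro _ ⟨n, rfl⟩; exact hd0 n, fun k hk z hz => ?_⟩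
    have hlim : Tendsto (fun n => d n z) atTop (𝓝 0) := by
      have := ((hsum z hz).hasSum.tendsto_sum_nat).const_sub (F z)
      rw [hF z hz, sub_self] at this
      simpa only [hd, hF z hz] using this
    exact ge_of_tendsto hlim (Eventually.of_forall fun n => hk ⟨n, rfl⟩ z hz)
  have hdir : DirectedOn (· ≥ ·) (Set.range d) := by
    rintro _ ⟨m, rfl⟩ _ ⟨n, rfl⟩
    exact ⟨d (max m n), ⟨_, rfl⟩, hdanti (le_max_left _ _), hdanti (le_max_right _ _)⟩
  have hM0 : 0 ≤ M := (norm_nonneg _).trans (hM' 0)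
  rw [Metric.tendsto_atTop]
  intro ε hε
  obtain ⟨_, ⟨n, rfl⟩, hn⟩ := hE (Set.range d) (Set.range_nonempty d) hdir hglb (ε / (M + 1))
    (by positivity)
  refine ⟨n, fun m hm => ?_⟩
  have h1 := hn (d m) ⟨m, rfl⟩ (hdanti hm)
  have h2 : |h (x m)| ≤ g |x m| := abs_le'.2
    ⟨(hgh _ (abs_nonneg _)).1 ⟨x m, le_rfl, rfl⟩,
      (hgh _ (abs_nonneg _)).1 ⟨-x m, (abs_neg (x m)).le, map_neg h _⟩⟩
  have h3 : f m |x m| ≤ d m |x m| := by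
    have := hd0 (m + 1) |x m| (abs_nonneg _)
    change 0 ≤ d (m + 1) |x m| at this
    rw [hd, Finset.sum_range_succ] at this
    rw [hd]
    linarith
  have h4 := apply_le_mul (g := d m) h1.le |x m|
  rw [Real.dist_eq, sub_zero]
  calc |h (x m)| ≤ ε / (M + 1) * ‖|x m|‖ := by rw [hfy] at h3; linarith
    _ ≤ ε / (M + 1) * M := mul_le_mul_of_nonneg_left (hM' m) (by positivity)
    _ < ε / (M + 1) * (M + 1) := mul_lt_mul_of_pos_left (by linarith) (by positivity)
    _ = ε := by field_simp

omit [NormedSpace ℝ E] [IsOrderedAddMonoid E] in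
theorem norm_le_of_mem_solidClosure_closedBall {x : E} {r : ℝ}
    (hx : x ∈ LatticeOrderedAddCommGroup.solidClosure (Metric.closedBall (0 : E) r)) :
    ‖x‖ ≤ r := by
  obtain ⟨y, hy, hxy⟩ := hx
  exact (norm_le_norm_of_abs_le_abs hxy).trans (mem_closedBall_zero_iff.1 hy)

/-- For a fixed `f₀` in `D`, some `u` satisfies `f₀ (|x| - u)⁺ ≤ ε / 4` on the unit ball, and some
`f₁` in `D` has `f₁ u < ε / 4`. Members of `D` below both have norm at most `ε / 2`. -/
theorem hasOrderContinuousNorm_dual_of_isWeaklyNull [CompleteSpace E] [IsOrderedModule ℝ E]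
    (H : ∀ x : ℕ → E, Bornology.IsBounded (Set.range x) → IsDisjointSeq x → IsWeaklyNull x) :
    HasOrderContinuousNorm (StrongDual ℝ E) := by
  intro D hne hdir hglb ε hε
  obtain ⟨f₀, hf₀⟩ := hne
  have hf₀0 : 0 ≤ f₀ := hglb.1 hf₀
  obtain ⟨u, hu, hxu⟩ := exists_forall_apply_posPart_abs_sub_le (ι := Unit) (g := fun _ => f₀)
    (fun _ => hf₀0) (fun _ => le_rfl) (Metric.isBounded_closedBall (x := (0 : E)) (r := 1))
    (fun v _ hv hdisj δ hδ => by
      have hb : Bornology.IsBounded (Set.range v) := isBounded_iff_forall_norm_le.2 ⟨1, by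
        rintro _ ⟨n, rfl⟩; exact norm_le_of_mem_solidClosure_closedBall (hv n)⟩
      filter_upwards [((isWeaklyNull_iff v).1 (H v hb hdisj) f₀).eventually_lt_const hδ] with n hn _
      exact hn.le) (show 0 < ε / 4 by positivity)
  obtain ⟨f₁, hf₁, hf₁u⟩ := exists_apply_lt_of_isGLB ⟨f₀, hf₀⟩ hdir hglb hu
    (show 0 < ε / 4 by positivity)
  obtain ⟨f, hf, hff₀, hff₁⟩ := hdir f₀ hf₀ f₁ hf₁
  refine ⟨f, hf, fun g hgD hgf => lt_of_le_of_lt (ContinuousLinearMap.opNorm_le_of_unit_norm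
    (by positivity) fun x hx => ?_) (half_lt_self hε)⟩
  have hg : 0 ≤ g := hglb.1 hgD
  have h1 : |x| ≤ (|x| - u)⁺ + u := sub_le_iff_le_add.1 (le_posPart _)
  have h2 := dual_monotone hg h1
  rw [map_add] at h2
  have h3 : g (|x| - u)⁺ ≤ f₀ (|x| - u)⁺ := hgf.trans hff₀ _ (posPart_nonneg _)
  have h4 : g u ≤ f₁ u := hgf.trans hff₁ u hu
  have h5 := hxu x (mem_closedBall_zero_iff.2 hx.le) ()
  have h6 := abs_apply_le hg x
  rw [Real.norm_eq_abs]
  linarith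

end OrderContinuity

/-! ### Weak compactness from disjoint sequences -/

section MWeaklyCompact

variable {E X : Type*} [NormedAddCommGroup E] [NormedSpace ℝ E] [Lattice E] [IsOrderedAddMonoid E]
  [HasSolidNorm E] [IsOrderedModule ℝ E] [CompleteSpace E]
  [NormedAddCommGroup X] [NormedSpace ℝ X] [CompleteSpace X]

/-- An operator that maps bounded disjoint sequences to norm null sequences is weakly compact. -/
theorem isWeaklyCompact_of_tendsto_of_isDisjointSeq {T : E →L[ℝ] X}
    (HT : ∀ x : ℕ → E, Bornology.IsBounded (Set.range x) → IsDisjointSeq x →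
      Tendsto (fun n => T (x n)) atTop (𝓝 0)) : IsWeaklyCompact T := by
  choose g hg0 hg using fun f : {f : StrongDual ℝ X // ‖f‖ ≤ 1} => exists_modulus (f.1.comp T)
  have hgle : ∀ f (x z : E), |z| ≤ x → f.1 (T z) ≤ g f x := fun f x z hz =>
    (hg f x ((abs_nonneg z).trans hz)).1 ⟨z, hz, rfl⟩
  have hfle : ∀ (f : {f : StrongDual ℝ X // ‖f‖ ≤ 1}) y, f.1 y ≤ ‖y‖ := fun f y =>
    (apply_le_mul f.2 y).trans_eq (one_mul _)
  have hgC : ∀ f, ‖g f‖ ≤ ‖T‖ := fun f => dual_norm_le (hg0 f) (norm_nonneg _) fun x hx => by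
    refine (isLUB_le_iff (hg f x hx)).2 ?_
    rintro _ ⟨z, hz, rfl⟩
    refine (hfle f (T z)).trans ((T.le_opNorm z).trans ?_)
    exact mul_le_mul_of_nonneg_left
      (norm_le_norm_of_abs_le_abs (by rwa [abs_of_nonneg hx])) (norm_nonneg _)
  have hTle : ∀ z c, (∀ f, g f |z| ≤ c) → ‖T z‖ ≤ c := fun z c h => by
    obtain ⟨f, hf1, hf⟩ := exists_dual_vector'' ℝ (T z)
    have h1 := hgle ⟨f, hf1⟩ |z| z le_rfl
    have h2 : f (T z) = ‖T z‖ := by simpa using hf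
    rw [← h2]
    exact h1.trans (h _)
  have hnull : ∀ v : ℕ → E, (∀ n, 0 ≤ v n) → Bornology.IsBounded (Set.range v) →
      IsDisjointSeq v → IsUniformlyNull g v := by
    intro v hv0 hvb hv ε hε
    obtain ⟨M, hM⟩ := isBounded_iff_forall_norm_le.1 hvb
    -- A large value of some `|f ∘ T|` at `v n` is witnessed by `‖T z‖` with `|z| ≤ v n`; such `z`
    -- inherit disjointness, so `HT` applies to them.
    have hex : ∀ n, ∃ z, |z| ≤ v n ∧ ((∃ f, ε < g f (v n)) → ε < ‖T z‖) := by
      intro n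
      by_cases h : ∃ f, ε < g f (v n)
      · obtain ⟨f, hf⟩ := h
        obtain ⟨_, ⟨z, hz, rfl⟩, hlt, -⟩ := (hg f _ (hv0 n)).exists_between hf
        exact ⟨z, hz, fun _ => hlt.trans_le (hfle f (T z))⟩
      · exact ⟨0, by simpa using hv0 n, fun h' => absurd h' h⟩
    choose z hz hzT using hex
    have hzd : IsDisjointSeq z := fun m n hmn => by
      have h := hv.abs_inf_abs hmn
      simp only [abs_of_nonneg (hv0 _)] at h
      exact le_antisymm ((inf_le_inf (hz m) (hz n)).trans h.le)
        (le_inf (abs_nonneg _) (abs_nonneg _))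
    have hzb : Bornology.IsBounded (Set.range z) := isBounded_iff_forall_norm_le.2 ⟨M, by
      rintro _ ⟨n, rfl⟩
      exact (norm_le_norm_of_abs_le_abs (by rw [abs_of_nonneg (hv0 n)]; exact hz n)).trans
        (hM _ ⟨n, rfl⟩)⟩
    filter_upwards [(HT z hzb hzd).norm.eventually_lt_const (by simpa using hε)] with n hn f
    by_contra! hlt
    exact absurd (hzT n ⟨f, hlt⟩) (not_lt.2 hn.le)
  refine isCompact_closure_of_convexHull_close
    ((convex_closedBall (0 : E) 1).linear_image T.toLinearMap)
    (T.lipschitz.isBounded_image Metric.isBounded_closedBall) fun a ha ε hε => ?_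
  choose x hx hxa using ha
  obtain ⟨u, hu, hxu⟩ := exists_forall_apply_posPart_abs_sub_le hg0 hgC
    (Metric.isBounded_closedBall (x := (0 : E)) (r := 1))
    (fun v hv0 hv hdisj => hnull v hv0 (isBounded_iff_forall_norm_le.2 ⟨1, by
        rintro _ ⟨n, rfl⟩; exact norm_le_of_mem_solidClosure_closedBall (hv n)⟩) hdisj)
    (show 0 < ε / 8 by positivity)
  have h2u : 0 ≤ u + u := add_nonneg hu hu
  obtain ⟨F, δ, hδ, hFδ⟩ := exists_finset_control hg0 hgC h2u
    (fun v hv0 hv hdisj => hnull v hv0 (isBounded_iff_forall_norm_le.2 ⟨‖u + u‖, by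
        rintro _ ⟨n, rfl⟩; exact norm_le_norm_of_nonneg_of_le (hv0 n) (hv n)⟩) hdisj)
    (show 0 < ε / 4 by positivity)
  -- Pairing each `x n` with its truncation lets the same convex coefficients act on both.
  let p : ℕ → E × E := fun n => (x n, (x n ⊓ u) ⊔ (-u))
  have hpu : ∀ n, |LinearMap.snd ℝ E E (p n)| ≤ u := fun n => abs_truncate_le (x n) hu
  obtain ⟨m, b, hb, c, hc, hbc⟩ := exists_convexHull_apply_abs_sub_le (LinearMap.snd ℝ E E) p hu
    hpu (g := ∑ f ∈ F, g f) (fun z hz => by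
      rw [sum_apply]; exact Finset.sum_nonneg fun f _ => hg0 f z hz) (half_pos hδ)
  have hrange : ∀ s : Set ℕ, ∀ b ∈ convexHull ℝ (p '' s), T b.1 ∈ convexHull ℝ (a '' s) ∧
      |b.2| ≤ u ∧ ‖T b.1 - T b.2‖ ≤ ε / 8 := by
    intro s b hb
    refine ⟨?_, abs_le_of_mem_convexHull (LinearMap.snd ℝ E E)
      (by rintro _ ⟨n, -, rfl⟩; exact hpu n) hb, ?_⟩
    · have h1 : convexHull ℝ (p '' s) ⊆
          (T.toLinearMap ∘ₗ LinearMap.fst ℝ E E) ⁻¹' convexHull ℝ (a '' s) := by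
        refine convexHull_min ?_ ((convex_convexHull ℝ _).linear_preimage _)
        rintro _ ⟨n, hn, rfl⟩
        exact subset_convexHull ℝ _ ⟨n, hn, (hxa n).symm⟩
      exact h1 hb
    · have h1 : convexHull ℝ (p '' s) ⊆
          (T.toLinearMap ∘ₗ (LinearMap.fst ℝ E E - LinearMap.snd ℝ E E)) ⁻¹'
            Metric.closedBall 0 (ε / 8) := by
        refine convexHull_min ?_ ((convex_closedBall _ _).linear_preimage _)
        rintro _ ⟨n, hn, rfl⟩
        refine mem_closedBall_zero_iff.2 (hTle _ _ fun f => ?_)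
        exact (dual_monotone (hg0 f) (abs_sub_truncate_le (x n) u)).trans (hxu _ (hx n) f)
      have h2 := mem_closedBall_zero_iff.1 (h1 hb)
      rw [← map_sub]
      exact h2
  obtain ⟨hb1, hb2, hb3⟩ := hrange _ b hb
  obtain ⟨hc1, hc2, hc3⟩ := hrange _ c hc
  refine ⟨m, _, hb1, _, hc1, ?_⟩
  have h1 : |b.2 - c.2| ≤ u + u := by
    rw [sub_eq_add_neg]
    refine (abs_add_le _ _).trans (add_le_add hb2 ?_)
    rwa [abs_neg]
  have h2 : ‖T (b.2 - c.2)‖ ≤ ε / 4 := hTle _ _ (hFδ _ (abs_nonneg _) h1 (by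
    rw [sum_apply] at hbc
    exact lt_of_le_of_lt hbc (half_lt_self hδ)))
  rw [map_sub] at h2
  calc ‖T b.1 - T c.1‖ = ‖(T b.1 - T b.2) + (T b.2 - T c.2) - (T c.1 - T c.2)‖ := by
        congr 1; abel
    _ ≤ ‖T b.1 - T b.2‖ + ‖T b.2 - T c.2‖ + ‖T c.1 - T c.2‖ :=
        (norm_sub_le _ _).trans (add_le_add_left (norm_add_le _ _) _)
    _ < ε := by linarith

end MWeaklyCompact

/-! ### Schur's lemma -/

section Schur

variable {ι : Type*}

/-- Schur's lemma for series: if all signed sums of `a n` tend to `0`, then so do the absolute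
sums. -/
theorem tendsto_tsum_abs_of_forall_sign {a : ℕ → ι → ℝ} (ha : ∀ n, Summable fun i => |a n i|)
    (h0 : ∀ i, Tendsto (fun n => a n i) atTop (𝓝 0))
    (h : ∀ σ : ι → Bool, Tendsto (fun n => ∑' i, (bif σ i then 1 else -1) * a n i) atTop (𝓝 0)) :
    Tendsto (fun n => ∑' i, |a n i|) atTop (𝓝 0) := by
  classical
  have hle : ∀ (b : Bool) (r : ℝ), |(bif b then 1 else -1) * r| = |r| := fun b r => by
    cases b <;> simp
  have hcont : ∀ n, Continuous fun σ : ι → Bool => ∑' i, (bif σ i then (1 : ℝ) else -1) * a n i := by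
    refine fun n => continuous_tsum (fun i => ?_) (ha n) fun i σ => by
      rw [Real.norm_eq_abs, hle]
    exact ((continuous_of_discreteTopology (f := fun b : Bool => bif b then (1 : ℝ) else -1)).comp
      (continuous_apply i)).mul continuous_const
  rw [Metric.tendsto_atTop]
  intro ε hε
  -- Baire category on the compact space of sign patterns: some closed `K m` contains all patterns
  -- agreeing with `σ₀` on a finite set `I`.
  let K : ℕ → Set (ι → Bool) := fun m =>
    {σ | ∀ n, m ≤ n → |∑' i, (bif σ i then 1 else -1) * a n i| ≤ ε / 4}
  have hK : ∀ m, IsClosed (K m) := fun m => by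
    have : K m = ⋂ n, ⋂ _ : m ≤ n, {σ | |∑' i, (bif σ i then 1 else -1) * a n i| ≤ ε / 4} := by
      ext σ; simp [K]
    rw [this]
    exact isClosed_iInter fun n => isClosed_iInter fun _ =>
      isClosed_le (hcont n).abs continuous_const
  have hKU : ⋃ m, K m = Set.univ := by
    refine Set.eq_univ_of_forall fun σ => Set.mem_iUnion.2 ?_
    have h1 := (h σ).abs
    rw [abs_zero] at h1
    obtain ⟨m, hm⟩ := eventually_atTop.1 (h1.eventually_lt_const (show 0 < ε / 4 by positivity))
    exact ⟨m, fun n hn => (hm n hn).le⟩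
  obtain ⟨m, σ₀, hσ₀⟩ := nonempty_interior_of_iUnion_of_closed hK hKU
  obtain ⟨I, U, hU, hUK⟩ := isOpen_pi_iff.1 isOpen_interior σ₀ hσ₀
  have hI : Tendsto (fun n => ∑ i ∈ I, 2 * |a n i|) atTop (𝓝 0) := by
    have := tendsto_finsetSum I fun i _ => ((h0 i).abs.const_mul 2)
    simpa using this
  obtain ⟨m', hm'⟩ := eventually_atTop.1 (hI.eventually_lt_const (show 0 < ε / 4 by positivity))
  refine ⟨max m m', fun n hn => ?_⟩
  -- Outside `I` the signs match those of `a n`, so the signed and absolute sums differ only on the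
  -- finite set `I`.
  let σ : ι → Bool := fun i => if i ∈ I then σ₀ i else decide (0 ≤ a n i)
  have hσ : σ ∈ K m := interior_subset (hUK fun i hi => by
    have : σ i = σ₀ i := if_pos hi
    rw [this]; exact (hU i hi).2)
  have h1 := hσ n ((le_max_left _ _).trans hn)
  have h2 := hm' n ((le_max_right _ _).trans hn)
  have hsσ : Summable fun i => (bif σ i then (1 : ℝ) else -1) * a n i :=
    Summable.of_norm (by simpa only [Real.norm_eq_abs, hle] using ha n)
  have h3 : ∑' i, |a n i| - ∑' i, (bif σ i then 1 else -1) * a n i ≤ ∑ i ∈ I, 2 * |a n i| := by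
    rw [← (ha n).tsum_sub hsσ, tsum_eq_sum (s := I)]
    · refine Finset.sum_le_sum fun i _ => ?_
      have := neg_abs_le ((bif σ i then 1 else -1) * a n i)
      rw [hle] at this
      linarith
    · intro i hi
      have : σ i = decide (0 ≤ a n i) := if_neg hi
      rw [this]
      by_cases h : 0 ≤ a n i
      · simp [h, abs_of_nonneg]
      · simp [h, abs_of_neg (not_le.1 h)]
  have h4 := (abs_le.1 h1).2
  rw [Real.dist_eq, sub_zero, abs_of_nonneg (tsum_nonneg fun i => abs_nonneg _)]
  linarith

end Schur

/-! ### Operators into `ℓ¹` -/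

section L1Operator

variable {E : Type*} [NormedAddCommGroup E] [NormedSpace ℝ E] {ι : Type*}

theorem lp_one_norm_le {b : lp (fun _ : ι => ℝ) 1} {c : ℝ} (hc : 0 ≤ c)
    (h : ∀ s : Finset ι, ∑ i ∈ s, |b i| ≤ c) : ‖b‖ ≤ c :=
  lp.norm_le_of_forall_sum_le (by simp) hc fun s => by simpa using h s

theorem lp_one_summable (b : lp (fun _ : ι => ℝ) 1) : Summable fun i => |b i| := by
  simpa using (lp.memℓp b).summable (by simp)

theorem lp_one_norm_eq (b : lp (fun _ : ι => ℝ) 1) : ‖b‖ = ∑' i, |b i| := by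
  rw [lp.norm_eq_tsum_rpow (by simp)]; simp

/-- The operator into `ℓ¹` whose coordinates are the functionals `f i`. -/
theorem exists_lpOneOperator (f : ι → StrongDual ℝ E) {C : ℝ} (hC : 0 ≤ C)
    (h : ∀ (s : Finset ι) (x : E), ∑ i ∈ s, |f i x| ≤ C * ‖x‖) :
    ∃ T : E →L[ℝ] lp (fun _ : ι => ℝ) 1, ∀ x i, T x i = f i x := by
  have hmem : ∀ x, Memℓp (fun i => f i x) (1 : ENNReal) := fun x =>
    memℓp_gen' (C := C * ‖x‖) fun s => by simpa using h s x
  let L : E →ₗ[ℝ] lp (fun _ : ι => ℝ) 1 :=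
    { toFun := fun x => ⟨fun i => f i x, hmem x⟩
      map_add' := fun x y => by ext i; exact map_add (f i) x y
      map_smul' := fun c x => by ext i; exact map_smul (f i) c x }
  exact ⟨L.mkContinuous C fun x => lp_one_norm_le (by positivity) fun s => h s x, fun x i => rfl⟩

/-- This is the Schur property of `ℓ¹`: each signed sum of coordinates is a bounded functional. -/
theorem isDunfordPettis_lpOne {T : E →L[ℝ] lp (fun _ : ι => ℝ) 1} : IsDunfordPettis T := by
  intro x hx
  have hx' := (isWeaklyNull_iff x).1 hx
  have hev : ∀ i (b : lp (fun _ : ι => ℝ) 1), lp.evalCLM ℝ (fun _ : ι => ℝ) 1 i b = b i :=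
    fun i b => rfl
  rw [tendsto_zero_iff_norm_tendsto_zero]
  simp only [lp_one_norm_eq]
  refine tendsto_tsum_abs_of_forall_sign (fun n => lp_one_summable _) (fun i => ?_) fun σ => ?_
  · exact hx' ((lp.evalCLM ℝ (fun _ : ι => ℝ) 1 i).comp T)
  · have hle : ∀ (b : Bool) (r : ℝ), |(bif b then 1 else -1) * r| = |r| := fun b r => by
      cases b <;> simp
    obtain ⟨S, hS⟩ := exists_lpOneOperator (E := lp (fun _ : ι => ℝ) 1)
      (fun i => (bif σ i then (1 : ℝ) else -1) • lp.evalCLM ℝ (fun _ : ι => ℝ) 1 i)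
      zero_le_one (fun s b => by
        simp only [smul_apply, smul_eq_mul, hle, hev]
        rw [one_mul, lp_one_norm_eq]
        exact (lp_one_summable b).sum_le_tsum s fun i _ => abs_nonneg _)
    have h := hx' (((lp.tsumCLM ℝ ι ℝ).comp S).comp T)
    have h2 : ∀ y, ((lp.tsumCLM ℝ ι ℝ).comp S).comp T y =
        ∑' i, (bif σ i then (1 : ℝ) else -1) * T y i := fun y => by
      change ∑' i, S (T y) i = _
      simp only [hS, smul_apply, smul_eq_mul, hev]
    simpa only [h2] using h

/-- A bounded set whose image in `ℓ¹` has uniformly small tails has relatively compact image. -/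
theorem isCompact_closure_image_lpOne {T : E →L[ℝ] lp (fun _ : ι => ℝ) 1} {A : Set E}
    (hA : Bornology.IsBounded A)
    (h : ∀ ε : ℝ, 0 < ε → ∃ s : Finset ι, ∀ x ∈ A, ∀ t : Finset ι, Disjoint t s →
      ∑ i ∈ t, |T x i| ≤ ε) : IsCompact (closure (T '' A)) := by
  classical
  refine TotallyBounded.isCompact_of_isClosed (TotallyBounded.closure ?_) isClosed_closure
  refine Metric.totallyBounded_iff.2 fun ε hε => ?_
  obtain ⟨s, hs⟩ := h (ε / 4) (by positivity)
  -- Keeping only the coordinates in `s` factors through a finite-dimensional space and moves `T x`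
  -- by at most `ε / 4`.
  let π : E →L[ℝ] (s → ℝ) :=
    ContinuousLinearMap.pi fun i => (lp.evalCLM ℝ (fun _ : ι => ℝ) 1 i.1).comp T
  let R : (s → ℝ) →L[ℝ] lp (fun _ : ι => ℝ) 1 := ∑ i : s,
    (ContinuousLinearMap.proj i).smulRight (lp.single 1 i.1 (1 : ℝ))
  have hR : ∀ (z : s → ℝ) j, R z j = if hj : j ∈ s then z ⟨j, hj⟩ else 0 := by
    intro z j
    simp only [R, sum_apply]
    rw [lp.coeFn_sum, Finset.sum_apply]
    have hterm : ∀ i : s, ((ContinuousLinearMap.proj (R := ℝ) (φ := fun _ : s => ℝ) i).smulRight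
        (lp.single 1 i.1 (1 : ℝ) : lp (fun _ : ι => ℝ) 1) z : lp (fun _ : ι => ℝ) 1) j =
        if j = i.1 then z i else 0 := by
      intro i
      change z i * (lp.single 1 i.1 (1 : ℝ) : lp (fun _ : ι => ℝ) 1) j = _
      rw [lp.single_apply]
      by_cases hji : j = i.1
      · subst hji; simp
      · simp [hji]
    simp only [hterm]
    by_cases hj : j ∈ s
    · rw [dif_pos hj, Finset.sum_eq_single ⟨j, hj⟩]
      · simp
      · intro i _ hi
        exact if_neg fun hji => hi (Subtype.ext hji.symm)
      · simp
    · rw [dif_neg hj]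
      exact Finset.sum_eq_zero fun i _ => if_neg fun (hji : j = i.1) => hj (hji ▸ i.2)
  have hcomp : IsCompact (R '' closure (π '' A)) :=
    (π.lipschitz.isBounded_image hA).isCompact_closure.image R.continuous
  obtain ⟨t, ht, htc⟩ := Metric.totallyBounded_iff.1 hcomp.totallyBounded (ε / 2) (by positivity)
  refine ⟨t, ht, ?_⟩
  rintro _ ⟨x, hx, rfl⟩
  obtain ⟨y, hy, hxy⟩ := Set.mem_iUnion₂.1 (htc ⟨π x, subset_closure ⟨x, hx, rfl⟩, rfl⟩)
  refine Set.mem_iUnion₂.2 ⟨y, hy, ?_⟩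
  have h1 : ‖T x - R (π x)‖ ≤ ε / 4 := by
    refine lp_one_norm_le (by positivity) fun r => ?_
    have h2 : ∀ i, |(T x - R (π x)) i| = if i ∈ s then 0 else |T x i| := by
      intro i
      rw [lp.coeFn_sub, Pi.sub_apply, hR]
      by_cases hi : i ∈ s
      · rw [dif_pos hi, if_pos hi]
        change |T x i - T x i| = 0
        simp
      · rw [dif_neg hi, if_neg hi, sub_zero]
    simp only [h2]
    calc ∑ i ∈ r, (if i ∈ s then 0 else |T x i|) = ∑ i ∈ r \ s, |T x i| := by
          rw [Finset.sdiff_eq_filter, Finset.sum_filter]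
          exact Finset.sum_congr rfl fun i _ => (ite_not _ _ _).symm
      _ ≤ ε / 4 := hs x hx _ Finset.sdiff_disjoint
  rw [Metric.mem_ball] at hxy ⊢
  rw [← dist_eq_norm] at h1
  calc dist (T x) y ≤ dist (T x) (R (π x)) + dist (R (π x)) y := dist_triangle _ _ _
    _ < ε := by linarith

/-- A weak limit along a free ultrafilter has all coordinates `0`, yet the sum of coordinates is a
bounded functional that stays above a positive constant. -/
theorem not_isWeaklyCompact_lpOne [Infinite ι] {T : E →L[ℝ] lp (fun _ : ι => ℝ) 1} {y : ι → E}
    {M ε : ℝ} (hε : 0 < ε) (hM : ∀ i, ‖y i‖ ≤ M) (h1 : ∀ i, ε ≤ T (y i) i)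
    (h2 : ∀ i j, i ≠ j → T (y j) i = 0) : ¬ IsWeaklyCompact T := by
  intro hT
  have hM0 : 0 < M + 1 := by
    have := (norm_nonneg _).trans (hM (Classical.arbitrary ι)); linarith
  let z : ι → E := fun i => (M + 1)⁻¹ • y i
  have hz : ∀ i, z i ∈ Metric.closedBall (0 : E) 1 := fun i => by
    rw [mem_closedBall_zero_iff, norm_smul, Real.norm_of_nonneg (by positivity),
      inv_mul_le_iff₀ hM0]
    linarith [hM i]
  let U : Ultrafilter ι := hyperfilter ι
  obtain ⟨w, -, hw⟩ := isCompact_iff_ultrafilter_le_nhds.1 hT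
    (U.map fun i => toWeakSpace ℝ _ (T (z i))) (by
      rw [le_principal_iff]
      exact Filter.mem_map.2 (Filter.univ_mem' fun i =>
        subset_closure ⟨_, ⟨_, hz i, rfl⟩, rfl⟩))
  have hlim : ∀ f : StrongDual ℝ (lp (fun _ : ι => ℝ) 1),
      Tendsto (fun i => f (T (z i))) U (𝓝 (f ((toWeakSpace ℝ _).symm w))) := fun f =>
    ((WeakBilin.eval_continuous (topDualPairing ℝ _).flip f).tendsto w).comp hw
  have hcoord : ∀ j, (toWeakSpace ℝ (lp (fun _ : ι => ℝ) 1)).symm w j = 0 := by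
    intro j
    refine tendsto_nhds_unique (hlim (lp.evalCLM ℝ (fun _ : ι => ℝ) 1 j)) ?_
    refine tendsto_const_nhds.congr' ?_
    have hj : ∀ᶠ i in (U : Filter ι), i ≠ j :=
      hyperfilter_le_cofinite (Set.finite_singleton j).compl_mem_cofinite
    filter_upwards [hj] with i hi
    change 0 = T ((M + 1)⁻¹ • y i) j
    rw [map_smul, lp.coeFn_smul, Pi.smul_apply, h2 j i hi.symm, smul_zero]
  have hw0 : (toWeakSpace ℝ (lp (fun _ : ι => ℝ) 1)).symm w = 0 := by
    ext j; exact hcoord j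
  have hs := hlim (lp.tsumCLM ℝ ι ℝ)
  rw [hw0, map_zero] at hs
  have hge : ∀ i, (M + 1)⁻¹ * ε ≤ lp.tsumCLM ℝ ι ℝ (T (z i)) := by
    intro i
    have hc : ∀ j, T (z i) j = (M + 1)⁻¹ * T (y i) j := fun j => by
      change T ((M + 1)⁻¹ • y i) j = _
      rw [map_smul]; rfl
    change _ ≤ ∑' j, T (z i) j
    rw [tsum_eq_single i fun j hj => by rw [hc, h2 j i hj, mul_zero], hc]
    exact mul_le_mul_of_nonneg_left (h1 i) (by positivity)
  have := ge_of_tendsto hs (Eventually.of_forall hge)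
  have hpos : 0 < (M + 1)⁻¹ * ε := by positivity
  linarith

end L1Operator

/-! ### The counterexample operator and the equivalences -/

section Characterization

variable {E : Type u} [NormedAddCommGroup E] [NormedSpace ℝ E] [Lattice E] [IsOrderedAddMonoid E]
  [HasSolidNorm E]

omit [IsOrderedAddMonoid E] in
theorem isDisjointlyWeaklyCompact_closedBall
    (H : ∀ x : ℕ → E, Bornology.IsBounded (Set.range x) → IsDisjointSeq x → IsWeaklyNull x) :
    IsDisjointlyWeaklyCompact (Metric.closedBall (0 : E) 1) :=
  ⟨Metric.isBounded_closedBall, fun x hx hdisj => H x (isBounded_iff_forall_norm_le.2 ⟨1, by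
    rintro _ ⟨n, rfl⟩; exact norm_le_of_mem_solidClosure_closedBall (hx n)⟩) hdisj⟩

omit [Lattice E] [IsOrderedAddMonoid E] [HasSolidNorm E] in
theorem isWeaklyCompact_of_isCompactOperator {X : Type v} [NormedAddCommGroup X] [NormedSpace ℝ X]
    {T : E →L[ℝ] X} (hT : IsCompactOperator T) : IsWeaklyCompact T := by
  have h : IsCompact (closure (T '' Metric.closedBall 0 1)) :=
    hT.isCompact_closure_image_closedBall 1
  have h2 : IsCompact (toWeakSpace ℝ X '' closure (T '' Metric.closedBall 0 1)) :=
    h.image (toWeakSpaceCLM ℝ X).continuous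
  exact h2.of_isClosed_subset isClosed_closure
    (closure_minimal (Set.image_mono subset_closure) h2.isClosed)

variable [CompleteSpace E] [IsOrderedModule ℝ E]

/-- If a bounded disjoint sequence of `E` is not weakly null, then some operator into `ℓ¹` is
DW-compact and Dunford-Pettis without being weakly compact. -/
theorem exists_not_isWeaklyCompact {x : ℕ → E} (hb : Bornology.IsBounded (Set.range x))
    (hx : IsDisjointSeq x) (hnot : ¬ IsWeaklyNull x) :
    ∃ T : E →L[ℝ] lp (fun _ : ULift.{v} ℕ => ℝ) 1,
      IsDWCompact T ∧ IsDunfordPettis T ∧ ¬ IsWeaklyCompact T := by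
  rw [isWeaklyNull_iff] at hnot
  push Not at hnot
  obtain ⟨h, hh⟩ := hnot
  obtain ⟨ε, hε, hfreq⟩ : ∃ ε > 0, ∃ᶠ n in atTop, ε ≤ |h (x n)| := by
    by_contra! hcon
    refine hh (Metric.tendsto_nhds.2 fun ε hε => ?_)
    filter_upwards [hcon ε hε] with n hn
    rwa [Real.dist_eq, sub_zero]
  obtain ⟨φ, hφ, hφε⟩ := extraction_of_frequently_atTop hfreq
  obtain ⟨g, hg, hgh⟩ := exists_modulus h
  obtain ⟨M, hM⟩ := isBounded_iff_forall_norm_le.1 hb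
  -- The lift of the index set places `ℓ¹` in the universe of the target spaces.
  let y : ULift.{v} ℕ → E := fun i => |x (φ i.down)|
  have hy0 : ∀ i, 0 ≤ y i := fun i => abs_nonneg _
  obtain ⟨f, hf0, hfy, hfij, hfs⟩ := exists_bandParts hg hy0 fun i j hij =>
    hx.abs_inf_abs fun h' => hij (ULift.down_injective (hφ.injective h'))
  have hfabs : ∀ (s : Finset (ULift.{v} ℕ)) z, ∑ i ∈ s, |f i z| ≤ ∑ i ∈ s, f i |z| := fun s z =>
    Finset.sum_le_sum fun i _ => abs_apply_le (hf0 i) z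
  obtain ⟨T, hT⟩ := exists_lpOneOperator f (norm_nonneg g) fun s z =>
    ((hfabs s z).trans (hfs s _ (abs_nonneg z))).trans
      ((apply_le_mul le_rfl _).trans_eq (by rw [norm_abs_eq_norm]))
  refine ⟨T, fun A hA => isCompact_closure_image_lpOne hA.1 fun δ hδ => ?_,
    isDunfordPettis_lpOne, ?_⟩
  -- Tails of `T z` are uniformly small on `A`: the part of `|z|` above `u` is small under `g ≥ ∑ f
  -- i`, and the rest is bounded by a tail of the summable `f i u`.
  · obtain ⟨u, hu, hAu⟩ := exists_forall_apply_posPart_abs_sub_le (ι := Unit) (g := fun _ => g)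
      (fun _ => hg) (fun _ => le_rfl) hA.1 (fun v _ hv hdisj η hη => by
        filter_upwards [((isWeaklyNull_iff v).1 (hA.2 v hv hdisj) g).eventually_lt_const hη]
          with n hn _
        exact hn.le) (half_pos hδ)
    have hsum : Summable fun i => f i u :=
      summable_of_sum_le (fun i => hf0 i u hu) fun s => hfs s u hu
    obtain ⟨s, hs⟩ := summable_iff_vanishing_norm.1 hsum (δ / 2) (half_pos hδ)
    refine ⟨s, fun z hz t ht => ?_⟩
    simp only [hT]
    calc ∑ i ∈ t, |f i z| ≤ ∑ i ∈ t, f i |z| := hfabs t z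
      _ ≤ ∑ i ∈ t, (f i (|z| - u)⁺ + f i u) := Finset.sum_le_sum fun i _ => by
          rw [← map_add]
          exact dual_monotone (hf0 i) (sub_le_iff_le_add.1 (le_posPart _))
      _ = ∑ i ∈ t, f i (|z| - u)⁺ + ∑ i ∈ t, f i u := Finset.sum_add_distrib
      _ ≤ δ / 2 + δ / 2 := add_le_add ((hfs t _ (posPart_nonneg _)).trans (hAu z hz ()))
          ((le_abs_self _).trans (hs t ht).le)
      _ = δ := add_halves δ
  · refine not_isWeaklyCompact_lpOne hε (M := M) (y := y)
      (fun i => by rw [norm_abs_eq_norm]; exact hM _ ⟨_, rfl⟩) (fun i => ?_)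
      fun i j hij => by rw [hT]; exact hfij i j hij
    rw [hT, hfy]
    refine (hφε i.down).trans (abs_le'.2 ⟨(hgh _ (hy0 i)).1 ⟨_, le_rfl, rfl⟩, ?_⟩)
    exact (hgh _ (hy0 i)).1 ⟨-x (φ i.down), (abs_neg _).le, map_neg h _⟩

end Characterization

end BanachLattice

theorem mainTheorem9 (E : Type u) [NormedAddCommGroup E] [NormedSpace ℝ E] [CompleteSpace E]
    [Lattice E] [IsOrderedAddMonoid E] [IsOrderedModule ℝ E] [HasSolidNorm E] :
    List.TFAE
      [ BanachLattice.HasReciprocalDDPProperty.{u, v} E,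
        BanachLattice.HasOrderContinuousNorm (StrongDual ℝ E),
        ∀ (X : Type v) [NormedAddCommGroup X] [NormedSpace ℝ X] [CompleteSpace X]
          (T : E →L[ℝ] X), BanachLattice.IsDWCompact T → IsCompactOperator T,
        BanachLattice.HasReciprocalDPProperty.{u, v} E ] := by
  tfae_have 1 → 2 := fun h => by
    refine BanachLattice.hasOrderContinuousNorm_dual_of_isWeaklyNull fun x hb hx => ?_
    by_contra hnot
    obtain ⟨T, hDW, -, hT⟩ := BanachLattice.exists_not_isWeaklyCompact.{u, v} hb hx hnot
    exact hT (h _ T hDW)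
  tfae_have 4 → 2 := fun h => by
    refine BanachLattice.hasOrderContinuousNorm_dual_of_isWeaklyNull fun x hb hx => ?_
    by_contra hnot
    obtain ⟨T, -, hDP, hT⟩ := BanachLattice.exists_not_isWeaklyCompact.{u, v} hb hx hnot
    exact hT (h _ T hDP)
  tfae_have 2 → 3 := fun h X _ _ _ T hT =>
    ⟨_, hT _ (BanachLattice.isDisjointlyWeaklyCompact_closedBall fun _ hb hx =>
      BanachLattice.isWeaklyNull_of_hasOrderContinuousNorm_dual h hb hx),
      Filter.mem_of_superset (Metric.closedBall_mem_nhds 0 one_pos) fun x hx =>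
        subset_closure ⟨x, hx, rfl⟩⟩
  tfae_have 3 → 1 := fun h X _ _ _ T hT =>
    BanachLattice.isWeaklyCompact_of_isCompactOperator (h X T hT)
  tfae_have 2 → 4 := fun h X _ _ _ T hT =>
    BanachLattice.isWeaklyCompact_of_tendsto_of_isDisjointSeq fun x hb hx =>
      hT x (BanachLattice.isWeaklyNull_of_hasOrderContinuousNorm_dual h hb hx)
  tfae_finish
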